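/- Let $G$ be a finite graph, that is, a connected multigraph without loops (multiple edges are allowed) with finite nonempty vertex set $V(G)$ and finitely many edges. A divisor on $G$ is an element $D=\sum_v D(v)\,v$ of the free abelian group on $V(G)$; its degree is $\sum_v D(v)$, and it is effective if $D(v)\ge 0$ for all $v$. Two divisors $D,D'$ are equivalent if $D'=D-L\sigma$ for some $\sigma\in\mathbb{Z}^{V(G)}$, where $L$ is the Laplacian matrix of $G$. Write $|D|$ for the set of effective divisors equivalent to $D$. The rank of $D$ is $-1$ if $|D|=\emptyset$, and otherwise it is the largest integer $k\ge 0$ such that $|D-F|\neq\emptyset$ for all effective divisors $F$ of degree $k$. For $r\ge 1$ let $\mathrm{dgon}_r(G)$ be the minimum degree of a divisor of rank $r$ on $G$, and let $\mathrm{sdgon}_r(G)$ be the minimum of $\mathrm{dgon}_r(H)$ over all subdivisions $H$ of $G$ (graphs obtained by replacing each edge $e$ of $G$ by a path with some number $n_e\ge 1$ of edges). Let $\Gamma(G)$ be the metric graph obtained from $G$ by giving every edge length $1$. A divisor on $\Gamma(G)$ is a finite $\mathbb{Z}$-linear combination of points of $\Gamma(G)$; degree and effectiveness are defined as before. Two divisors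 are equivalent if they differ by $\sum_{p}\mathrm{ord}_p(f)\,p$ for some continuous function $f:\Gamma(G)\to\mathbb{R}$ that is piecewise linear with finitely many pieces and integer slopes on every edge, where $\mathrm{ord}_p(f)$ is the sum of the outgoing slopes of $f$ at $p$. The rank of a divisor is defined as before, and $\mathrm{dgon}_r(\Gamma(G))$ is the minimum degree of a divisor of rank $r$ on $\Gamma(G)$. Then for every $r\geq 1$ all these minima exist, and \[\mathrm{sdgon}_r(G)\;\leq\;\mathrm{dgon}_r(\Gamma(G))\;\leq\;\mathrm{dgon}_r(G).\] -/

import Mathlib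

open Set Graph

/-! ### Divisors, linear systems, rank and gonality with respect to an equivalence of divisors

A divisor on a set of points `X` is an element of the free abelian group `X →₀ ℤ`; its degree is
`Finsupp.degree`, and it is effective when `0 ≤ D`. The definitions of rank and gonality are the
same for finite graphs and for metric graphs, only the equivalence relation `R` differs. -/

namespace DivisorTheory

/-- The set `|D|` of all effective divisors equivalent to `D`. -/
def linearSystem {X : Type*} (R : (X →₀ ℤ) → (X →₀ ℤ) → Prop) (D : X →₀ ℤ) : Set (X →₀ ℤ) :=
  {D' | 0 ≤ D' ∧ R D D'}

open Classical in
/-- The rank of `D`: it is `-1` if `|D|` is empty, and otherwise the maximal `k` such that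
`|D - F|` is nonempty for all effective divisors `F` of degree `k`. -/
noncomputable def rank {X : Type*} (R : (X →₀ ℤ) → (X →₀ ℤ) → Prop) (D : X →₀ ℤ) : ℤ :=
  if linearSystem R D = ∅ then -1
  else ((sSup {k : ℕ | ∀ F : X →₀ ℤ, 0 ≤ F → F.degree = (k : ℤ) →
    (linearSystem R (D - F)).Nonempty} : ℕ) : ℤ)

/-- The set of degrees of the divisors of rank `r`. -/
def rankDegrees {X : Type*} (R : (X →₀ ℤ) → (X →₀ ℤ) → Prop) (r : ℕ) : Set ℤ :=
  {d | ∃ D : X →₀ ℤ, rank R D = (r : ℤ) ∧ D.degree = d}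

end DivisorTheory

namespace Graph

/-! ### Finite graphs -/

/-- A multigraph is connected if it has a vertex and any two vertices are joined by a walk. -/
def IsConnected {α β : Type*} (G : Graph α β) : Prop :=
  V(G).Nonempty ∧ ∀ x ∈ V(G), ∀ y ∈ V(G), Relation.ReflTransGen G.Adj x y

open Classical in
/-- The Laplacian of a loopless multigraph: valences on the diagonal, and minus the number of edges
joining `v` and `w` off the diagonal. -/
noncomputable def laplacian {α β : Type*} (G : Graph α β) : Matrix V(G) V(G) ℤ := fun v w =>
  if v = w then ((G.incidenceSet (v : α)).ncard : ℤ)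
  else -(({e | G.IsLink e (v : α) (w : α)} : Set β).ncard : ℤ)

/-- Equivalence of divisors on a finite graph: `D' = D - L σ` for an integer vector `σ`.
(The sum is over the vertices of `G`, which are finitely many.) -/
def DivEquiv {α β : Type*} (G : Graph α β) (D D' : V(G) →₀ ℤ) : Prop :=
  ∃ σ : V(G) → ℤ, ∀ v, D' v = D v - ∑ᶠ w, G.laplacian v w * σ w

/-- The degrees of the divisors of rank `r` on a finite graph. -/
def dgonDegrees {α β : Type*} (G : Graph α β) (r : ℕ) : Set ℤ :=
  DivisorTheory.rankDegrees G.DivEquiv r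

/-- The `r`-th divisorial gonality of a finite graph: the minimal degree of a divisor of
rank `r`. -/
noncomputable def dgon {α β : Type*} (G : Graph α β) (r : ℕ) : ℤ :=
  sInf (G.dgonDegrees r)

/-! ### Subdivisions -/

/-- One end of the edge `e`, chosen once and for all. -/
noncomputable def src {α β : Type*} (G : Graph α β) (e : E(G)) : V(G) :=
  ⟨(exists_isLink_of_mem_edgeSet e.2).choose,
    (exists_isLink_of_mem_edgeSet e.2).choose_spec.choose_spec.left_mem⟩

/-- The other end of the edge `e`. -/
noncomputable def tgt {α β : Type*} (G : Graph α β) (e : E(G)) : V(G) :=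
  ⟨(exists_isLink_of_mem_edgeSet e.2).choose_spec.choose,
    (exists_isLink_of_mem_edgeSet e.2).choose_spec.choose_spec.right_mem⟩

lemma isLink_src_tgt {α β : Type*} (G : Graph α β) (e : E(G)) :
    G.IsLink (e : β) (G.src e : α) (G.tgt e : α) :=
  (exists_isLink_of_mem_edgeSet e.2).choose_spec.choose_spec

/-- The `i`-th vertex (`0 ≤ i ≤ n e`) of the path with `n e` edges that replaces the edge `e`. -/
noncomputable def pathVertex {α β : Type*} (G : Graph α β) (n : E(G) → ℕ) (e : E(G)) (i : ℕ) :
    α ⊕ (E(G) × ℕ) :=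
  if i = 0 then Sum.inl (G.src e : α)
  else if i < n e then Sum.inr (e, i)
  else Sum.inl (G.tgt e : α)

/-- The subdivision of `G` in which every edge `e` is replaced by a path consisting of `n e` edges,
that is, in which `n e - 1` two-valent vertices `(e, 1), …, (e, n e - 1)` have been introduced in
the middle of `e`. The edges of the path are `(e, 0), …, (e, n e - 1)`. Intended for `1 ≤ n e`. -/
noncomputable def subdivide {α β : Type*} (G : Graph α β) (n : E(G) → ℕ) :
    Graph (α ⊕ (E(G) × ℕ)) (E(G) × ℕ) where
  vertexSet := {p | (∃ v ∈ V(G), p = Sum.inl v) ∨ ∃ e i, 0 < i ∧ i < n e ∧ p = Sum.inr (e, i)}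
  IsLink a p q := a.2 < n a.1 ∧
    s(p, q) = s(G.pathVertex n a.1 a.2, G.pathVertex n a.1 (a.2 + 1))
  isLink_symm := fun a _ => ⟨fun p q h => ⟨h.1, by rw [Sym2.eq_swap]; exact h.2⟩⟩
  eq_or_eq_of_isLink_of_isLink := by
    intro a x y v w h h'
    have h2 := h.2.trans h'.2.symm
    rw [Sym2.eq_iff] at h2
    tauto
  left_mem_of_isLink := by
    have key : ∀ (e : E(G)) (i : ℕ), G.pathVertex n e i ∈
        {p : α ⊕ (E(G) × ℕ) | (∃ v ∈ V(G), p = Sum.inl v) ∨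
          ∃ e i, 0 < i ∧ i < n e ∧ p = Sum.inr (e, i)} := by
      intro e i
      unfold pathVertex
      split_ifs with h1 h2
      · exact Or.inl ⟨_, (G.src e).2, rfl⟩
      · exact Or.inr ⟨e, i, Nat.pos_of_ne_zero h1, h2, rfl⟩
      · exact Or.inl ⟨_, (G.tgt e).2, rfl⟩
    intro a x y h
    have h2 := h.2
    rw [Sym2.eq_iff] at h2
    rcases h2 with ⟨rfl, -⟩ | ⟨rfl, -⟩
    · exact key _ _
    · exact key _ _

/-- The `r`-th divisorial gonalities of all subdivisions of a finite graph. -/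
def sdgonValues {α β : Type*} (G : Graph α β) (r : ℕ) : Set ℤ :=
  {d | ∃ n : E(G) → ℕ, (∀ e, 1 ≤ n e) ∧ (G.subdivide n).dgon r = d}

/-- The `r`-th stable divisorial gonality of a finite graph: the minimal `r`-th divisorial gonality
of a subdivision. -/
noncomputable def sdgon {α β : Type*} (G : Graph α β) (r : ℕ) : ℤ :=
  sInf (G.sdgonValues r)

end Graph

/-! ### Metric graphs -/

/-- The points of the metric graph given by a graph `G` and edge lengths `ℓ`: the vertices of `G`,
and for every edge `e` an open interval of length `ℓ e`. -/
inductive MetricGraph {α β : Type*} (G : Graph α β) (ℓ : E(G) → ℝ) : Type _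
  | vertex (v : V(G)) : MetricGraph G ℓ
  | edgePoint (e : E(G)) (t : Ioo 0 (ℓ e)) : MetricGraph G ℓ

namespace MetricGraph

open Classical in
/-- The parametrization of the closed edge `e` by `[0, ℓ e]`, where `0` is sent to one end of `e`
and `ℓ e` to the other; it is extended to `ℝ` by constants. -/
noncomputable def edgePath {α β : Type*} {G : Graph α β} {ℓ : E(G) → ℝ} (e : E(G)) (t : ℝ) :
    MetricGraph G ℓ :=
  if h0 : t ≤ 0 then vertex (G.src e)
  else if h1 : t < ℓ e then edgePoint e ⟨t, not_le.1 h0, h1⟩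
  else vertex (G.tgt e)

/-- The topology of a metric graph: the closed edges are glued at their ends, that is, a set is open
if and only if its inverse image under the parametrization of every edge is open. -/
noncomputable instance {α β : Type*} {G : Graph α β} {ℓ : E(G) → ℝ} : TopologicalSpace (MetricGraph G ℓ) :=
  ⨆ e : E(G), TopologicalSpace.coinduced (edgePath e) inferInstance

/-- Tropical rational functions: continuous functions whose restriction to every edge is piecewise
linear with finitely many pieces and integer slopes. The set `S` contains the break points in the
interior of the edge `e`. -/
def IsRational {α β : Type*} {G : Graph α β} {ℓ : E(G) → ℝ} (f : MetricGraph G ℓ → ℝ) : Prop :=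
  Continuous f ∧ ∀ e : E(G), ∃ S : Finset ℝ, ∀ a b : ℝ, 0 ≤ a → a < b → b ≤ ℓ e →
    (∀ s ∈ S, s ∉ Ioo a b) →
      ∃ (m : ℤ) (c : ℝ), ∀ t ∈ Icc a b, f (edgePath e t) = m * t + c

open Classical in
/-- The order of a rational function `f` at a point: the sum of the slopes of `f` in all directions
emanating from the point. Along the edge `e`, the slope of `f` towards the target is the right
derivative, and the slope towards the source is minus the left derivative. -/
noncomputable def ord {α β : Type*} {G : Graph α β} {ℓ : E(G) → ℝ} (f : MetricGraph G ℓ → ℝ) :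
    MetricGraph G ℓ → ℝ
  | vertex v => ∑ᶠ e : E(G),
      ((if G.src e = v then derivWithin (fun s => f (edgePath e s)) (Ici 0) 0 else 0) +
        (if G.tgt e = v then -derivWithin (fun s => f (edgePath e s)) (Iic (ℓ e)) (ℓ e) else 0))
  | edgePoint e t =>
      derivWithin (fun s => f (edgePath e s)) (Ici (t : ℝ)) t +
        -derivWithin (fun s => f (edgePath e s)) (Iic (t : ℝ)) t

/-- Equivalence of divisors on a metric graph: they differ by the divisor `∑ p, ord f p • p` of a
rational function `f`. -/
def DivEquiv {α β : Type*} (G : Graph α β) (ℓ : E(G) → ℝ) (D D' : MetricGraph G ℓ →₀ ℤ) : Prop :=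
  ∃ f : MetricGraph G ℓ → ℝ, IsRational f ∧ ∀ p, (D' p : ℝ) = D p + ord f p

/-- The degrees of the divisors of rank `r` on a metric graph. -/
def dgonDegrees {α β : Type*} (G : Graph α β) (ℓ : E(G) → ℝ) (r : ℕ) : Set ℤ :=
  DivisorTheory.rankDegrees (DivEquiv G ℓ) r

/-- The `r`-th divisorial gonality of a metric graph: the minimal degree of a divisor of
rank `r`. -/
noncomputable def dgon {α β : Type*} (G : Graph α β) (ℓ : E(G) → ℝ) (r : ℕ) : ℤ :=
  sInf (dgonDegrees G ℓ r)

end MetricGraph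

/-- The edge lengths of the metric graph `Γ(G)`: all edges have length `1`. -/
def Graph.unitLength {α β : Type*} (G : Graph α β) : E(G) → ℝ := fun _ => 1

/-! Both inequalities rest on one fact: the vertices of $G$ are rank-determining, on every
subdivision of $G$ and on $\Gamma(G)$ alike. If $|D-v|\ne\emptyset$ for every vertex $v$, then
$|D-x|\ne\emptyset$ for every point $x$ (`subdivide_oldVertex_determining`, `vertex_determining`).
To see this for $x$ on the edge $e$, take members $D_1,D_2$ of $|D|$ with chips at the two ends of
$e$, write $D_2-D_1$ as the divisor of $f$, and truncate to $\max(f,f(x))$. The new divisor is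
effective with chips on $e$ on both sides of $x$, and moving two such chips towards each other
brings one to $x$. Hence rank at least $r$ needs to be tested only on the finitely many sums of $r$
vertices. For $\mathrm{dgon}_r(\Gamma(G))\le\mathrm{dgon}_r(G)$, the linear extension of an integer
function on $V(G)$ has the same divisor, so a divisor of $G$ passes every vertex test on $\Gamma(G)$
that it passes on $G$ (`rankGE_mapDomain_vertex`). For
$\mathrm{sdgon}_r(G)\le\mathrm{dgon}_r(\Gamma(G))$, take $D$ of rank $r$ and minimal degree.
Finitely many rational functions witness the vertex tests, with possibly irrational break points and
values. A $\mathbb{Q}$-linear functional near the inclusion into $\mathbb{R}$ of the span of these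
numbers, multiplied by a common denominator, gives an additive $\varphi$ that is integral on them
and keeps their order (`exists_addMonoidHom_integral_pos`). Applied to positions and values,
$\varphi$ preserves slopes because they are integers, so all witnesses become functions on the
subdivision with $\varphi(1)$ edges per edge (`exists_subdivision`). The minimum over rank exactly
$r$ equals the minimum over rank at least $r$, since removing a chip lowers the rank by at most one
(`isLeast_rankDegrees`). -/

namespace DivisorTheory

/-! ### Rank and minimal degree for an abstract equivalence of divisors -/

/-- The effective divisor that is the sum of the points of a list. -/
noncomputable def listDivisor {X : Type*} (l : List X) : X →₀ ℤ :=
  (l.map fun x => Finsupp.single x (1 : ℤ)).sum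

lemma listDivisor_cons {X : Type*} (x : X) (l : List X) :
    listDivisor (x :: l) = Finsupp.single x 1 + listDivisor l := by
  simp [listDivisor]

lemma listDivisor_nonneg {X : Type*} (l : List X) : 0 ≤ listDivisor l := by
  induction l with
  | nil => simp [listDivisor]
  | cons x l ih =>
    rw [listDivisor_cons]
    exact add_nonneg (Finsupp.single_nonneg.2 zero_le_one) ih

lemma degree_listDivisor {X : Type*} (l : List X) : (listDivisor l).degree = (l.length : ℤ) := by
  induction l with
  | nil => simp [listDivisor]
  | cons x l ih =>
    rw [listDivisor_cons, map_add, ih]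
    simp [add_comm]

lemma mapDomain_listDivisor {X Y : Type*} (f : X → Y) (l : List X) :
    Finsupp.mapDomain f (listDivisor l) = listDivisor (l.map f) := by
  induction l with
  | nil => simp [listDivisor]
  | cons x l ih =>
    rw [listDivisor_cons, Finsupp.mapDomain_add, ih, List.map_cons, listDivisor_cons,
      Finsupp.mapDomain_single]

lemma degree_nonneg {X : Type*} {F : X →₀ ℤ} (hF : 0 ≤ F) : 0 ≤ F.degree := by
  rw [Finsupp.degree_apply]
  exact Finset.sum_nonneg fun i _ => hF i

lemma degree_mapDomain {X Y : Type*} (f : X → Y) (D : X →₀ ℤ) :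
    (Finsupp.mapDomain f D).degree = D.degree := by
  classical
  induction D using Finsupp.induction_linear with
  | zero => simp
  | add a b ha hb => rw [Finsupp.mapDomain_add, map_add, map_add, ha, hb]
  | single a b => simp [Finsupp.mapDomain_single]

lemma mapDomain_nonneg {X Y : Type*} (f : X → Y) {D : X →₀ ℤ} (hD : 0 ≤ D) :
    0 ≤ Finsupp.mapDomain f D := by
  classical
  intro y
  rw [Finsupp.mapDomain, Finsupp.sum_apply, Finsupp.sum]
  refine Finset.sum_nonneg fun i _ => ?_
  rw [Finsupp.single_apply]
  split_ifs
  · exact hD i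
  · exact le_rfl

lemma sub_single_nonneg {X : Type*} {D : X →₀ ℤ} (hD : 0 ≤ D) {x : X} (hx : 1 ≤ D x) :
    0 ≤ D - Finsupp.single x 1 := by
  classical
  intro y
  have := hD y
  simp only [Finsupp.coe_zero, Pi.zero_apply, Finsupp.coe_sub, Pi.sub_apply, Finsupp.single_apply]
    at this ⊢
  split_ifs with h
  · subst h; omega
  · omega

lemma exists_listDivisor_eq {X : Type*} (k : ℕ) : ∀ {F : X →₀ ℤ}, 0 ≤ F → F.degree = (k : ℤ) →
    ∃ l : List X, l.length = k ∧ listDivisor l = F := by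
  induction k with
  | zero =>
    intro F hF hk
    refine ⟨[], rfl, ?_⟩
    rw [Finsupp.degree_apply] at hk
    have := (Finset.sum_eq_zero_iff_of_nonneg (fun i _ => hF i)).1 hk
    ext x
    by_cases hx : x ∈ F.support
    · simpa [listDivisor] using (this x hx).symm
    · simpa [listDivisor] using (Finsupp.notMem_support_iff.1 hx).symm
  | succ k ih =>
    intro F hF hk
    have : ∃ x, 1 ≤ F x := by
      by_contra! h
      have : F = 0 := by
        ext x
        have h1 := h x
        have h2 := hF x
        simp only [Finsupp.coe_zero, Pi.zero_apply] at h2 ⊢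
        omega
      rw [this] at hk
      simp at hk
      omega
    obtain ⟨x, hx⟩ := this
    obtain ⟨l, hl, hlF⟩ := ih (sub_single_nonneg hF hx) (by
      rw [map_sub, hk]; simp)
    refine ⟨x :: l, by simp [hl], ?_⟩
    rw [listDivisor_cons, hlF]
    abel

/-- All effective divisors of degree `k` can be subtracted from `D` within the linear system. -/
def RankGE {X : Type*} (R : (X →₀ ℤ) → (X →₀ ℤ) → Prop) (k : ℕ) (D : X →₀ ℤ) : Prop :=
  ∀ F : X →₀ ℤ, 0 ≤ F → F.degree = (k : ℤ) → (linearSystem R (D - F)).Nonempty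

/-- Here and below `P` stands for the principal divisors. The rank arguments use only that
equivalence is congruence modulo a subgroup, so they serve finite and metric graphs at once. -/
lemma linearSystem_add_nonempty {X : Type*} {R : (X →₀ ℤ) → (X →₀ ℤ) → Prop}
    {P : AddSubgroup (X →₀ ℤ)} (hR : ∀ A B, R A B ↔ B - A ∈ P) {A B : X →₀ ℤ} (hB : 0 ≤ B)
    (h : (linearSystem R A).Nonempty) : (linearSystem R (A + B)).Nonempty := by
  obtain ⟨E, hE, hE'⟩ := h
  refine ⟨E + B, add_nonneg hE hB, ?_⟩
  rw [hR] at hE' ⊢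
  simpa using hE'

lemma linearSystem_sub_single_nonempty {X : Type*} {R : (X →₀ ℤ) → (X →₀ ℤ) → Prop}
    {P : AddSubgroup (X →₀ ℤ)} (hR : ∀ A B, R A B ↔ B - A ∈ P) {D : X →₀ ℤ} {x : X} :
    (linearSystem R (D - Finsupp.single x 1)).Nonempty ↔ ∃ E, 0 ≤ E ∧ E - D ∈ P ∧ 1 ≤ E x := by
  constructor
  · rintro ⟨E, hE, hE'⟩
    refine ⟨E + Finsupp.single x 1, add_nonneg hE (Finsupp.single_nonneg.2 zero_le_one), ?_, ?_⟩
    · rw [hR] at hE'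
      convert hE' using 1
      abel
    · have := hE x
      simp only [Finsupp.coe_zero, Pi.zero_apply, Finsupp.coe_add, Pi.add_apply,
        Finsupp.single_eq_same] at this ⊢
      omega
  · rintro ⟨E, hE, hE', hx⟩
    refine ⟨E - Finsupp.single x 1, sub_single_nonneg hE hx, ?_⟩
    rw [hR]
    simpa using hE'

lemma RankGE.sub_single {X : Type*} {R : (X →₀ ℤ) → (X →₀ ℤ) → Prop} {k : ℕ} {D : X →₀ ℤ}
    (h : RankGE R (k + 1) D) (x : X) : RankGE R k (D - Finsupp.single x 1) := by
  intro F hF hk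
  have := h (Finsupp.single x 1 + F) (add_nonneg (Finsupp.single_nonneg.2 zero_le_one) hF)
    (by rw [map_add, hk]; simp [add_comm])
  rwa [← sub_sub] at this

lemma RankGE.of_succ {X : Type*} [Nonempty X] {R : (X →₀ ℤ) → (X →₀ ℤ) → Prop}
    {P : AddSubgroup (X →₀ ℤ)} (hR : ∀ A B, R A B ↔ B - A ∈ P) {k : ℕ} {D : X →₀ ℤ}
    (h : RankGE R (k + 1) D) : RankGE R k D := by
  obtain ⟨x⟩ := ‹Nonempty X›
  intro F hF hk
  have := linearSystem_add_nonempty hR (Finsupp.single_nonneg.2 zero_le_one)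
    (h.sub_single x F hF hk) (B := Finsupp.single x 1)
  convert this using 2
  abel

lemma RankGE.mono {X : Type*} [Nonempty X] {R : (X →₀ ℤ) → (X →₀ ℤ) → Prop}
    {P : AddSubgroup (X →₀ ℤ)} (hR : ∀ A B, R A B ↔ B - A ∈ P) {k l : ℕ} (hkl : k ≤ l)
    {D : X →₀ ℤ} (h : RankGE R l D) : RankGE R k D := by
  induction l, hkl using Nat.le_induction with
  | base => exact h
  | succ l _ ih => exact ih (h.of_succ hR)

/-- Test with `k` chips on a single point: a class with an effective member has nonnegative degree.
This bounds the ranks from above and the degrees from below. -/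
lemma RankGE.le_degree {X : Type*} [Nonempty X] {R : (X →₀ ℤ) → (X →₀ ℤ) → Prop}
    (hdeg : ∀ A B, R A B → 0 ≤ B → 0 ≤ A.degree) {k : ℕ} {D : X →₀ ℤ}
    (h : RankGE R k D) : (k : ℤ) ≤ D.degree := by
  obtain ⟨x⟩ := ‹Nonempty X›
  obtain ⟨E, hE, hE'⟩ := h (Finsupp.single x k) (Finsupp.single_nonneg.2 (by positivity)) (by simp)
  have := hdeg _ _ hE' hE
  rw [map_sub] at this
  simp at this
  exact this

/-- The admissible `k` are closed downwards and bounded by the degree, so the supremum in `rank` is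
a genuine maximum whenever the linear system is nonempty. -/
lemma rank_eq_iff {X : Type*} [Nonempty X] {R : (X →₀ ℤ) → (X →₀ ℤ) → Prop}
    {P : AddSubgroup (X →₀ ℤ)} (hR : ∀ A B, R A B ↔ B - A ∈ P)
    (hdeg : ∀ A B, R A B → 0 ≤ B → 0 ≤ A.degree) {r : ℕ} {D : X →₀ ℤ} :
    rank R D = (r : ℤ) ↔ RankGE R r D ∧ ¬ RankGE R (r + 1) D := by
  have hbdd : BddAbove {k : ℕ | RankGE R k D} :=
    ⟨D.degree.toNat, fun k hk => by have := hk.le_degree hdeg; omega⟩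
  have h0 : RankGE R 0 D ↔ (linearSystem R D).Nonempty := by
    constructor
    · intro h
      simpa using h 0 le_rfl (by simp)
    · intro h F hF hk
      obtain ⟨l, hl, rfl⟩ := exists_listDivisor_eq 0 hF hk
      rw [List.length_eq_zero_iff] at hl
      subst hl
      simpa [listDivisor] using h
  by_cases he : linearSystem R D = ∅
  · rw [rank, if_pos he]
    constructor
    · intro h; omega
    · rintro ⟨h, -⟩
      have := h0.1 (h.mono hR (Nat.zero_le r))
      rw [he] at this
      exact absurd this Set.not_nonempty_empty
  · have hne : {k : ℕ | RankGE R k D}.Nonempty := ⟨0, h0.2 (Set.nonempty_iff_ne_empty.2 he)⟩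
    rw [rank, if_neg he]
    change ((sSup {k : ℕ | RankGE R k D} : ℕ) : ℤ) = r ↔ _
    rw [Nat.cast_inj]
    constructor
    · rintro rfl
      refine ⟨Nat.sSup_mem hne hbdd, fun h => ?_⟩
      have := le_csSup hbdd h
      omega
    · rintro ⟨h, h'⟩
      refine le_antisymm ?_ (le_csSup hbdd h)
      by_contra! hlt
      exact h' ((Nat.sSup_mem hne hbdd : RankGE R _ D).mono hR hlt)

/-- A divisor of minimal degree among those satisfying `RankGE R r` cannot satisfy `RankGE R (r +
1)`: removing one chip would leave `RankGE R r` in smaller degree. So its rank is exactly `r`. -/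
lemma isLeast_rankDegrees {X : Type*} [Nonempty X] {R : (X →₀ ℤ) → (X →₀ ℤ) → Prop}
    {P : AddSubgroup (X →₀ ℤ)} (hR : ∀ A B, R A B ↔ B - A ∈ P)
    (hdeg : ∀ A B, R A B → 0 ≤ B → 0 ≤ A.degree) {r : ℕ} {D : X →₀ ℤ} (hD : RankGE R r D) :
    IsLeast (rankDegrees R r) (sInf (rankDegrees R r)) ∧ sInf (rankDegrees R r) ≤ D.degree ∧
      0 ≤ sInf (rankDegrees R r) := by
  set S : Set ℤ := {d | ∃ D : X →₀ ℤ, RankGE R r D ∧ D.degree = d} with hS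
  have hne : S.Nonempty := ⟨_, D, hD, rfl⟩
  have hbdd : BddBelow S := ⟨r, by rintro _ ⟨D, hD, rfl⟩; exact hD.le_degree hdeg⟩
  have hsub : rankDegrees R r ⊆ S := by
    rintro _ ⟨D, hD, rfl⟩
    exact ⟨D, ((rank_eq_iff hR hdeg).1 hD).1, rfl⟩
  have hmem : sInf S ∈ rankDegrees R r := by
    obtain ⟨D, hD, hDd⟩ := Int.csInf_mem hne hbdd
    refine ⟨D, (rank_eq_iff hR hdeg).2 ⟨hD, fun h => ?_⟩, hDd⟩
    obtain ⟨x⟩ := ‹Nonempty X›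
    have := csInf_le hbdd ⟨_, h.sub_single x, rfl⟩
    rw [map_sub, hDd] at this
    simp at this
  have hleast : IsLeast (rankDegrees R r) (sInf S) := ⟨hmem, fun d hd => csInf_le hbdd (hsub hd)⟩
  have heq : sInf (rankDegrees R r) = sInf S := hleast.csInf_eq
  rw [heq]
  refine ⟨hleast, csInf_le hbdd ⟨D, hD, rfl⟩, ?_⟩
  obtain ⟨D, hD, hDd⟩ := hsub hmem
  have := hD.le_degree hdeg
  omega

/-- If `A` is such that a divisor class whose effective members meet every point of `A` meets
all points, then the rank can be tested on effective divisors that are supported on `A`. -/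
lemma rankGE_of_determining {X Y : Type*} {R : (X →₀ ℤ) → (X →₀ ℤ) → Prop} (ι : Y → X)
    (hdet : ∀ D : X →₀ ℤ, (∀ y, (linearSystem R (D - Finsupp.single (ι y) 1)).Nonempty) →
      ∀ x, (linearSystem R (D - Finsupp.single x 1)).Nonempty) {k : ℕ} {D : X →₀ ℤ}
    (h : ∀ l : List Y, l.length = k → (linearSystem R (D - listDivisor (l.map ι))).Nonempty) :
    RankGE R k D := by
  -- Trade points of the determining set for arbitrary points one at a time: `l` holds those already
  -- arbitrary, `l'` those still in the image of `ι`.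
  have key : ∀ l : List X, ∀ l' : List Y, l.length + l'.length = k →
      (linearSystem R (D - listDivisor l - listDivisor (l'.map ι))).Nonempty := by
    intro l
    induction l with
    | nil =>
      intro l' hl'
      have := h l' (by simpa using hl')
      simpa [listDivisor] using this
    | cons x l ih =>
      intro l' hl'
      have := hdet (D - listDivisor l - listDivisor (l'.map ι)) (fun y => by
        have := ih (y :: l') (by simp only [List.length_cons] at hl' ⊢; omega)
        rw [List.map_cons, listDivisor_cons] at this
        convert this using 2
        abel) x
      rw [listDivisor_cons]
      convert this using 2
      abel
  intro F hF hk
  obtain ⟨l, hl, rfl⟩ := exists_listDivisor_eq k hF hk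
  simpa [listDivisor] using key l [] (by simpa using hl)

end DivisorTheory

/-! ### Principal divisors of a finite multigraph -/

namespace Graph

open Classical in
/-- The divisor of an integer valued function `σ` on the vertices of a finite multigraph with
edges `i` from `s i` to `t i`: the sum of the outgoing differences. -/
noncomputable def edgeDiv {ι X : Type*} [Fintype ι] (s t : ι → X) (σ : X → ℤ) (x : X) : ℤ :=
  ∑ i, ((if s i = x then σ (t i) - σ x else 0) + (if t i = x then σ (s i) - σ x else 0))

lemma edgeDiv_add {ι X : Type*} [Fintype ι] (s t : ι → X) (σ τ : X → ℤ) (x : X) :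
    edgeDiv s t (σ + τ) x = edgeDiv s t σ x + edgeDiv s t τ x := by
  unfold edgeDiv
  rw [← Finset.sum_add_distrib]
  refine Finset.sum_congr rfl fun i _ => ?_
  simp only [Pi.add_apply]
  split_ifs <;> ring

lemma edgeDiv_neg {ι X : Type*} [Fintype ι] (s t : ι → X) (σ : X → ℤ) (x : X) :
    edgeDiv s t (-σ) x = -edgeDiv s t σ x := by
  unfold edgeDiv
  rw [← Finset.sum_neg_distrib]
  refine Finset.sum_congr rfl fun i _ => ?_
  simp only [Pi.neg_apply]
  split_ifs <;> ring

lemma edgeDiv_const {ι X : Type*} [Fintype ι] (s t : ι → X) (c : ℤ) (x : X) :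
    edgeDiv s t (fun _ => c) x = 0 := by
  simp [edgeDiv]

/-- If `τ` touches `σ` from above at `x`, all outgoing differences at `x` can only grow. This is
what makes truncations by a maximum yield effective divisors. -/
lemma edgeDiv_mono {ι X : Type*} [Fintype ι] (s t : ι → X) {σ τ : X → ℤ} (h : σ ≤ τ) {x : X}
    (hx : σ x = τ x) : edgeDiv s t σ x ≤ edgeDiv s t τ x := by
  unfold edgeDiv
  refine Finset.sum_le_sum fun i _ => ?_
  have h1 : σ (s i) ≤ τ (s i) := h _
  have h2 : σ (t i) ≤ τ (t i) := h _
  split_ifs <;> omega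

lemma sum_edgeDiv {ι X : Type*} [Fintype ι] [Fintype X] (s t : ι → X) (σ : X → ℤ) :
    ∑ x, edgeDiv s t σ x = 0 := by
  unfold edgeDiv
  rw [Finset.sum_comm]
  refine Finset.sum_eq_zero fun i _ => ?_
  rw [Finset.sum_add_distrib, Finset.sum_eq_single (s i), Finset.sum_eq_single (t i)]
  · simp
  · intro x _ hx
    rw [if_neg hx.symm]
  · simp
  · intro x _ hx
    rw [if_neg hx.symm]
  · simp

/-- The group of principal divisors of a finite multigraph with edges `i` from `s i` to `t i`. -/
noncomputable def principal {ι X : Type*} [Fintype ι] (s t : ι → X) : AddSubgroup (X →₀ ℤ) where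
  carrier := {A | ∃ σ : X → ℤ, ∀ x, A x = edgeDiv s t σ x}
  zero_mem' := ⟨fun _ => 0, fun x => by simp [edgeDiv_const]⟩
  add_mem' := by
    rintro A B ⟨σ, hσ⟩ ⟨τ, hτ⟩
    exact ⟨σ + τ, fun x => by rw [edgeDiv_add, Finsupp.add_apply, hσ, hτ]⟩
  neg_mem' := by
    rintro A ⟨σ, hσ⟩
    exact ⟨-σ, fun x => by rw [edgeDiv_neg, Finsupp.neg_apply, hσ]⟩

lemma exists_mem_principal {ι X : Type*} [Fintype ι] [Finite X] (s t : ι → X) (σ : X → ℤ) :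
    ∃ A ∈ principal s t, ∀ x, A x = edgeDiv s t σ x :=
  ⟨Finsupp.equivFunOnFinite.symm (edgeDiv s t σ), ⟨σ, fun _ => rfl⟩, fun _ => rfl⟩

lemma degree_eq_zero_of_mem_principal {ι X : Type*} [Fintype ι] [Finite X] {s t : ι → X}
    {A : X →₀ ℤ} (hA : A ∈ principal s t) : A.degree = 0 := by
  have := Fintype.ofFinite X
  obtain ⟨σ, hσ⟩ := hA
  rw [Finsupp.degree_eq_sum]
  simp_rw [hσ]
  exact sum_edgeDiv s t σ

/-- The Laplacian is the incidence matrix of any orientation times its transpose. The free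
enumeration `ed` of the edges lets the formula apply both to `G` and to subdivisions, whose edges
are indexed by a sigma type. -/
lemma laplacian_apply_eq_sum {α β ι : Type*} [Fintype ι] (G : Graph α β) (hloop : G.Loopless)
    (ed : ι → β) (hinj : Function.Injective ed) (hsurj : ∀ e ∈ E(G), ∃ i, ed i = e)
    (s t : ι → V(G)) (hl : ∀ i, G.IsLink (ed i) (s i) (t i)) (v w : V(G)) :
    G.laplacian v w = ∑ i, ((Set.indicator {s i} 1 v - Set.indicator {t i} 1 v) *
      (Set.indicator {s i} 1 w - Set.indicator {t i} 1 w) : ℤ) := by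
  classical
  have hne : ∀ i, s i ≠ t i := fun i h => (hl i).ne (congrArg Subtype.val h)
  have hcard : ∀ S : Set β, S ⊆ E(G) →
      (S.ncard : ℤ) = ∑ i, if ed i ∈ S then (1 : ℤ) else 0 := by
    intro S hS
    have h1 : S = ed '' {i | ed i ∈ S} := by
      ext e
      constructor
      · intro he
        obtain ⟨i, rfl⟩ := hsurj e (hS he)
        exact ⟨i, he, rfl⟩
      · rintro ⟨i, hi, rfl⟩
        exact hi
    rw [h1, Set.ncard_image_of_injective _ hinj, ← h1, Finset.sum_boole,
      ← Set.ncard_coe_finset]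
    simp
  have hinc : ∀ i (x : V(G)), G.Inc (ed i) x ↔ s i = x ∨ t i = x := by
    intro i x
    constructor
    · intro h
      rcases h.eq_or_eq_of_isLink (hl i) with h | h
      · exact Or.inl (Subtype.ext h.symm)
      · exact Or.inr (Subtype.ext h.symm)
    · rintro (rfl | rfl)
      · exact (hl i).inc_left
      · exact (hl i).inc_right
  unfold laplacian
  split_ifs with h
  · subst h
    rw [hcard _ (G.incidenceSet_subset_edgeSet _)]
    refine Finset.sum_congr rfl fun i _ => ?_
    simp only [mem_incidenceSet, hinc, Set.indicator_apply, Set.mem_singleton_iff, Pi.one_apply]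
    have := hne i
    by_cases h1 : s i = v <;> by_cases h2 : t i = v
    · exact absurd (h1.trans h2.symm) this
    all_goals simp [h1, h2, eq_comm (a := v)]
  · rw [hcard _ (fun e he => he.edge_mem), ← Finset.sum_neg_distrib]
    refine Finset.sum_congr rfl fun i _ => ?_
    have hlink : G.IsLink (ed i) v w ↔ (s i = v ∧ t i = w) ∨ (s i = w ∧ t i = v) := by
      rw [(hl i).isLink_iff]
      simp only [Subtype.ext_iff]
    simp only [Set.mem_ofPred_eq, hlink, Set.indicator_apply, Set.mem_singleton_iff, Pi.one_apply]
    have h3 := hne i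
    by_cases h1 : v = s i
    · subst h1
      simp [h3, h, eq_comm (a := w), h3.symm]
    · by_cases h2 : v = t i
      · subst h2
        simp only [h3, h, eq_comm (a := w), h3.symm]
        split_ifs <;> simp_all
      · simp [h1, h2, Ne.symm h1, Ne.symm h2]

lemma finsum_laplacian {α β ι : Type*} [Fintype ι] (G : Graph α β) [Finite V(G)]
    (hloop : G.Loopless)
    (ed : ι → β) (hinj : Function.Injective ed) (hsurj : ∀ e ∈ E(G), ∃ i, ed i = e)
    (s t : ι → V(G)) (hl : ∀ i, G.IsLink (ed i) (s i) (t i)) (σ : V(G) → ℤ) (v : V(G)) :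
    ∑ᶠ w, G.laplacian v w * σ w = -edgeDiv s t σ v := by
  classical
  have := Fintype.ofFinite V(G)
  have hne : ∀ i, s i ≠ t i := fun i h => (hl i).ne (congrArg Subtype.val h)
  rw [finsum_eq_sum_of_fintype, edgeDiv, ← Finset.sum_neg_distrib]
  simp_rw [laplacian_apply_eq_sum G hloop ed hinj hsurj s t hl, Finset.sum_mul]
  rw [Finset.sum_comm]
  refine Finset.sum_congr rfl fun i _ => ?_
  simp_rw [mul_assoc, ← Finset.mul_sum, sub_mul, Finset.sum_sub_distrib]
  simp only [Set.indicator_apply, Set.mem_singleton_iff, Pi.one_apply, ite_mul, one_mul, zero_mul,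
    Finset.sum_ite_eq', Finset.mem_univ, if_true]
  have h3 := hne i
  by_cases h1 : v = s i
  · subst h1
    simp [h3, h3.symm]
  · by_cases h2 : v = t i
    · subst h2
      simp [h3, h3.symm]
    · simp [h1, h2, Ne.symm h1, Ne.symm h2]

lemma divEquiv_iff_mem_principal {α β ι : Type*} [Fintype ι] (G : Graph α β) [Finite V(G)]
    (hloop : G.Loopless)
    (ed : ι → β) (hinj : Function.Injective ed) (hsurj : ∀ e ∈ E(G), ∃ i, ed i = e)
    (s t : ι → V(G)) (hl : ∀ i, G.IsLink (ed i) (s i) (t i)) (D D' : V(G) →₀ ℤ) :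
    G.DivEquiv D D' ↔ D' - D ∈ principal s t := by
  refine exists_congr fun σ => forall_congr' fun v => ?_
  rw [finsum_laplacian G hloop ed hinj hsurj s t hl, Finsupp.sub_apply]
  constructor <;> intro h <;> omega

lemma divEquiv_iff {α β : Type*} (G : Graph α β) [Finite V(G)] [Fintype E(G)]
    (hloop : G.Loopless) (D D' : V(G) →₀ ℤ) :
    G.DivEquiv D D' ↔ D' - D ∈ principal G.src G.tgt :=
  divEquiv_iff_mem_principal G hloop (fun e : E(G) => (e : β)) Subtype.val_injective
    (fun e he => ⟨⟨e, he⟩, rfl⟩) G.src G.tgt G.isLink_src_tgt D D'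

/-! ### Vertices and edges of a subdivision -/

/-- The `i`-th vertex of the path that replaces the edge `e`. -/
noncomputable def pathPoint {α β : Type*} (G : Graph α β) (n : E(G) → ℕ) (e : E(G)) (i : ℕ) :
    V(G.subdivide n) :=
  ⟨G.pathVertex n e i, by
    unfold pathVertex
    split_ifs with h1 h2
    · exact Or.inl ⟨_, (G.src e).2, rfl⟩
    · exact Or.inr ⟨e, i, Nat.pos_of_ne_zero h1, h2, rfl⟩
    · exact Or.inl ⟨_, (G.tgt e).2, rfl⟩⟩

/-- A vertex of a graph as a vertex of a subdivision. -/
def oldVertex {α β : Type*} (G : Graph α β) (n : E(G) → ℕ) (v : V(G)) : V(G.subdivide n) :=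
  ⟨Sum.inl v, Or.inl ⟨v, v.2, rfl⟩⟩

lemma oldVertex_injective {α β : Type*} (G : Graph α β) (n : E(G) → ℕ) :
    Function.Injective (G.oldVertex n) := fun _ _ h =>
  Subtype.ext (Sum.inl_injective (congrArg Subtype.val h))

lemma pathPoint_zero {α β : Type*} (G : Graph α β) (n : E(G) → ℕ) (e : E(G)) :
    G.pathPoint n e 0 = G.oldVertex n (G.src e) := rfl

lemma pathPoint_of_le {α β : Type*} (G : Graph α β) (n : E(G) → ℕ) (e : E(G)) {i : ℕ}
    (h0 : 0 < i) (hi : n e ≤ i) : G.pathPoint n e i = G.oldVertex n (G.tgt e) :=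
  Subtype.ext (by simp [pathPoint, pathVertex, h0.ne', hi.not_gt, oldVertex])

lemma pathPoint_val {α β : Type*} (G : Graph α β) (n : E(G) → ℕ) (e : E(G)) {i : ℕ}
    (h0 : 0 < i) (hi : i < n e) : (G.pathPoint n e i : α ⊕ (E(G) × ℕ)) = Sum.inr (e, i) := by
  simp [pathPoint, pathVertex, h0.ne', hi]

lemma pathPoint_eq_iff {α β : Type*} (G : Graph α β) (n : E(G) → ℕ) {e e' : E(G)} {i i' : ℕ}
    (h0 : 0 < i) (hi : i < n e) :
    G.pathPoint n e' i' = G.pathPoint n e i ↔ e' = e ∧ i' = i := by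
  constructor
  · intro h
    have := congrArg Subtype.val h
    rw [pathPoint_val G n e h0 hi] at this
    unfold pathPoint pathVertex at this
    dsimp only at this
    split_ifs at this
    simpa using this
  · rintro ⟨rfl, rfl⟩
    rfl

lemma exists_eq_of_vertex_subdivide {α β : Type*} (G : Graph α β) (n : E(G) → ℕ)
    (x : V(G.subdivide n)) : (∃ v, x = G.oldVertex n v) ∨
      ∃ e i, 0 < i ∧ i < n e ∧ x = G.pathPoint n e i := by
  rcases x.2 with ⟨v, hv, h⟩ | ⟨e, i, h0, hi, h⟩
  · exact Or.inl ⟨⟨v, hv⟩, Subtype.ext h⟩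
  · exact Or.inr ⟨e, i, h0, hi, Subtype.ext (h.trans (pathPoint_val G n e h0 hi).symm)⟩

lemma pathPoint_ne_oldVertex {α β : Type*} (G : Graph α β) (n : E(G) → ℕ) (e : E(G)) {i : ℕ}
    (h0 : 0 < i) (hi : i < n e) (v : V(G)) : G.pathPoint n e i ≠ G.oldVertex n v := by
  intro h
  have := congrArg Subtype.val h
  rw [pathPoint_val G n e h0 hi] at this
  simp [oldVertex] at this

lemma src_ne_tgt {α β : Type*} (G : Graph α β) (hloop : G.Loopless) (e : E(G)) :
    G.src e ≠ G.tgt e := fun h => (G.isLink_src_tgt e).ne (congrArg Subtype.val h)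

instance {α β : Type*} (G : Graph α β) [Finite V(G)] [Finite E(G)] (n : E(G) → ℕ) :
    Finite V(G.subdivide n) := by
  refine Finite.of_surjective
    (fun x : V(G) ⊕ (Σ e : E(G), Fin (n e)) => match x with
      | Sum.inl v => G.oldVertex n v
      | Sum.inr ⟨e, i⟩ => G.pathPoint n e i) fun x => ?_
  rcases exists_eq_of_vertex_subdivide G n x with ⟨v, rfl⟩ | ⟨e, i, -, hi, rfl⟩
  · exact ⟨Sum.inl v, rfl⟩
  · exact ⟨Sum.inr ⟨e, ⟨i, hi⟩⟩, rfl⟩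

lemma pathPoint_ne_succ {α β : Type*} (G : Graph α β) (hloop : G.Loopless) (n : E(G) → ℕ)
    (e : E(G)) {i : ℕ} (hi : i < n e) : G.pathPoint n e i ≠ G.pathPoint n e (i + 1) := by
  rcases Nat.eq_zero_or_pos i with rfl | h0
  · intro h
    by_cases h1 : 1 < n e
    · have := (pathPoint_eq_iff G n one_pos h1).1 h
      omega
    · rw [pathPoint_zero, pathPoint_of_le G n e (by omega) (by omega)] at h
      exact src_ne_tgt G hloop e (oldVertex_injective G n h)
  · intro h
    have := (pathPoint_eq_iff G n h0 hi).1 h.symm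
    omega

lemma subdivide_loopless {α β : Type*} (G : Graph α β) (hloop : G.Loopless) (n : E(G) → ℕ) :
    (G.subdivide n).Loopless := by
  constructor
  rintro a x ⟨ha, hx⟩
  rw [Sym2.eq_iff] at hx
  refine pathPoint_ne_succ G hloop n a.1 ha (Subtype.ext ?_)
  rcases hx with ⟨h1, h2⟩ | ⟨h1, h2⟩
  · exact h1.symm.trans h2
  · exact h2.symm.trans h1

/-- The divisor of a function on the vertices of a subdivision. -/
noncomputable def subdivDiv {α β : Type*} (G : Graph α β) [Fintype E(G)] (n : E(G) → ℕ)
    (σ : V(G.subdivide n) → ℤ) : V(G.subdivide n) → ℤ :=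
  edgeDiv (ι := Σ e : E(G), Fin (n e)) (fun a => G.pathPoint n a.1 a.2)
    (fun a => G.pathPoint n a.1 (a.2 + 1)) σ

/-- The group of principal divisors of a subdivision. -/
noncomputable def subdivPrincipal {α β : Type*} (G : Graph α β) [Fintype E(G)] (n : E(G) → ℕ) :
    AddSubgroup (V(G.subdivide n) →₀ ℤ) :=
  principal (ι := Σ e : E(G), Fin (n e)) (fun a => G.pathPoint n a.1 a.2)
    (fun a => G.pathPoint n a.1 (a.2 + 1))

lemma subdivide_divEquiv_iff {α β : Type*} (G : Graph α β) [Finite V(G)] [Fintype E(G)]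
    (hloop : G.Loopless) (n : E(G) → ℕ) (D D' : V(G.subdivide n) →₀ ℤ) :
    (G.subdivide n).DivEquiv D D' ↔ D' - D ∈ G.subdivPrincipal n := by
  refine divEquiv_iff_mem_principal (ι := Σ e : E(G), Fin (n e)) (G.subdivide n)
    (subdivide_loopless G hloop n)
    (fun a => (a.1, (a.2 : ℕ))) ?_ ?_ _ _ ?_ D D'
  · rintro ⟨e, i⟩ ⟨e', i'⟩ h
    simp only [Prod.mk.injEq] at h
    obtain ⟨rfl, h⟩ := h
    rw [Fin.ext h]
  · rintro ⟨e, i⟩ he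
    obtain ⟨x, y, h⟩ := exists_isLink_of_mem_edgeSet he
    exact ⟨⟨e, ⟨i, h.1⟩⟩, rfl⟩
  · rintro ⟨e, i⟩
    exact ⟨i.2, rfl⟩

/-- Only the path edges numbered `i - 1` and `i` meet an interior vertex, so the divisor there is a
second difference. -/
lemma subdivDiv_pathPoint {α β : Type*} (G : Graph α β) [Fintype E(G)] (n : E(G) → ℕ)
    (σ : V(G.subdivide n) → ℤ) (e : E(G)) {i : ℕ} (h0 : 0 < i) (hi : i < n e) :
    G.subdivDiv n σ (G.pathPoint n e i) = σ (G.pathPoint n e (i + 1)) +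
      σ (G.pathPoint n e (i - 1)) - 2 * σ (G.pathPoint n e i) := by
  classical
  unfold subdivDiv edgeDiv
  simp_rw [pathPoint_eq_iff G n h0 hi]
  rw [Fintype.sum_sigma, Finset.sum_eq_single e, Finset.sum_add_distrib,
    Finset.sum_eq_single ⟨i, hi⟩, Finset.sum_eq_single ⟨i - 1, by omega⟩]
  · simp only [true_and, if_true]
    rw [if_pos (by omega)]
    ring
  · intro j _ hj
    rw [if_neg]
    rintro ⟨-, h⟩
    refine hj (Fin.ext ?_)
    change (j : ℕ) = i - 1
    dsimp only at h
    omega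
  · simp
  · intro j _ hj
    rw [if_neg]
    rintro ⟨-, h⟩
    exact hj (Fin.ext h)
  · simp
  · intro e' _ he
    refine Finset.sum_eq_zero fun j _ => ?_
    simp [he]
  · simp

open Classical in
lemma subdivDiv_oldVertex {α β : Type*} (G : Graph α β) [Fintype E(G)] (n : E(G) → ℕ)
    (hn : ∀ e, 1 ≤ n e)
    (σ : V(G.subdivide n) → ℤ) (v : V(G)) :
    G.subdivDiv n σ (G.oldVertex n v) =
      ∑ e, ((if G.src e = v then σ (G.pathPoint n e 1) - σ (G.oldVertex n v) else 0) +
        (if G.tgt e = v then σ (G.pathPoint n e (n e - 1)) - σ (G.oldVertex n v) else 0)) := by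
  unfold subdivDiv edgeDiv
  rw [Fintype.sum_sigma]
  refine Finset.sum_congr rfl fun e _ => ?_
  have := hn e
  rw [Finset.sum_add_distrib, Finset.sum_eq_single ⟨0, by omega⟩,
    Finset.sum_eq_single ⟨n e - 1, by omega⟩]
  · simp only [pathPoint_zero,
      pathPoint_of_le G n e (i := n e - 1 + 1) (by omega) (by omega), (oldVertex_injective G n).eq_iff, zero_add]
  · intro j _ hj
    rw [if_neg]
    refine pathPoint_ne_oldVertex G n e (by omega) ?_ v
    have h1 := j.2
    have h2 : (j : ℕ) ≠ n e - 1 := fun h => hj (Fin.ext h)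
    dsimp only
    omega
  · simp
  · intro j _ hj
    rw [if_neg]
    have h2 : (j : ℕ) ≠ 0 := fun h => hj (Fin.ext h)
    exact pathPoint_ne_oldVertex G n e (by omega) j.2 v
  · simp

end Graph

/-! ### Chip moves on subdivisions; old vertices are rank-determining -/

namespace Graph

open DivisorTheory

lemma subdivDiv_mono {α β : Type*} (G : Graph α β) [Fintype E(G)] (n : E(G) → ℕ)
    {σ τ : V(G.subdivide n) → ℤ} (h : σ ≤ τ) {x : V(G.subdivide n)} (hx : σ x = τ x) :
    G.subdivDiv n σ x ≤ G.subdivDiv n τ x := edgeDiv_mono _ _ h hx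

/-- If an effective divisor on a subdivision has a chip on the path of an edge on either side of
the `i`-th vertex of that path, then an equivalent effective divisor has a chip at this vertex. -/
lemma exists_chip_of_chips_on_path {α β : Type*} (G : Graph α β) [Finite V(G)] [Fintype E(G)]
    (hloop : G.Loopless) (n : E(G) → ℕ) (hn : ∀ e, 1 ≤ n e) {D : V(G.subdivide n) →₀ ℤ}
    (hD : 0 ≤ D) (e : E(G)) {a i b : ℕ} (hai : a ≤ i) (hib : i ≤ b) (hb : b ≤ n e)
    (hDa : 1 ≤ D (G.pathPoint n e a)) (hDb : 1 ≤ D (G.pathPoint n e b)) :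
    ∃ E, 0 ≤ E ∧ E - D ∈ G.subdivPrincipal n ∧ 1 ≤ E (G.pathPoint n e i) := by
  classical
  rcases hai.eq_or_lt with rfl | hai
  · exact ⟨D, hD, by simp, hDa⟩
  rcases hib.eq_or_lt with rfl | hib
  · exact ⟨D, hD, by simp, hDb⟩
  -- The number of steps after which the first of the two chips reaches `i`.
  obtain ⟨δ, hδ⟩ : ∃ δ : ℤ, δ = min ((i : ℤ) - a) (b - i) := ⟨_, rfl⟩
  -- A trapezoid: zero outside `(a, b)`, descending with slope `-1` from both ends to depth `δ`. It
  -- removes one chip at `a` and at `b`, and adds one at `a + δ` and at `b - δ`, one of which is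
  -- `i`.
  obtain ⟨g, hg⟩ : ∃ g : ℕ → ℤ, ∀ j, g j = min 0 (max (max ((a : ℤ) - j) (j - b)) (-δ)) :=
    ⟨_, fun _ => rfl⟩
  obtain ⟨σ, hσ⟩ : ∃ σ : V(G.subdivide n) → ℤ, ∀ x, σ x = match (x : α ⊕ (E(G) × ℕ)) with
    | Sum.inl _ => 0
    | Sum.inr y => if y.1 = e then g y.2 else 0 := ⟨_, fun _ => rfl⟩
  have hσo : ∀ v, σ (G.oldVertex n v) = 0 := fun v => by rw [hσ]; rfl
  have hσe : ∀ j ≤ n e, σ (G.pathPoint n e j) = g j := by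
    intro j hj
    rcases Nat.eq_zero_or_pos j with rfl | h0
    · rw [pathPoint_zero, hσo, hg]
      omega
    rcases hj.eq_or_lt with rfl | hj
    · rw [pathPoint_of_le G n e h0 le_rfl, hσo, hg]
      omega
    · rw [hσ, pathPoint_val G n e h0 hj]
      simp
  have hσe' : ∀ e' ≠ e, ∀ j, σ (G.pathPoint n e' j) = 0 := by
    intro e' he' j
    rcases Nat.eq_zero_or_pos j with rfl | h0
    · rw [pathPoint_zero, hσo]
    rcases le_or_gt (n e') j with hj | hj
    · rw [pathPoint_of_le G n e' h0 hj, hσo]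
    · rw [hσ, pathPoint_val G n e' h0 hj]
      simp [he']
  obtain ⟨A, hA, hAσ⟩ := exists_mem_principal (ι := Σ e : E(G), Fin (n e))
    (fun a => G.pathPoint n a.1 a.2) (fun a => G.pathPoint n a.1 (a.2 + 1)) σ
  change ∀ x, A x = G.subdivDiv n σ x at hAσ
  change A ∈ G.subdivPrincipal n at hA
  refine ⟨D + A, ?_, by simpa using hA, ?_⟩
  · intro x
    have hDx : 0 ≤ D x := hD x
    rw [Finsupp.add_apply, hAσ, Finsupp.coe_zero, Pi.zero_apply]
    rcases exists_eq_of_vertex_subdivide G n x with ⟨v, rfl⟩ | ⟨e', j, h0, hj, rfl⟩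
    -- An old vertex loses a chip only if it is an end of `e` with `a = 0` or `b = n e`, and there
    -- `D` has a chip.
    · rw [subdivDiv_oldVertex G n hn, Finset.sum_eq_single e]
      · have h1 := hn e
        have hst := src_ne_tgt G hloop e
        rw [hσo, hσe _ h1, hσe _ (Nat.sub_le _ _), hg, hg]
        by_cases hs : G.src e = v
        · have ht : G.tgt e ≠ v := fun h => hst (hs.trans h.symm)
          rw [if_pos hs, if_neg ht]
          rcases Nat.eq_zero_or_pos a with rfl | ha
          · rw [pathPoint_zero, hs] at hDa
            push_cast
            omega
          · push_cast
            omega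
        · rw [if_neg hs]
          split_ifs with ht
          · rcases hb.eq_or_lt with rfl | hb
            · rw [pathPoint_of_le G n e h1 le_rfl, ht] at hDb
              omega
            · omega
          · omega
      · intro e' _ he'
        simp [hσe' e' he', hσo]
      · simp
    · rw [subdivDiv_pathPoint G n σ e' h0 hj]
      by_cases he' : e' = e
      · subst he'
        rw [hσe _ (by omega), hσe _ (by omega), hσe _ (by omega), hg, hg, hg]
        rcases eq_or_ne j a with rfl | hja
        · push_cast
          omega
        · rcases eq_or_ne j b with rfl | hjb
          · push_cast
            omega
          · push_cast
            omega
      · simp [hσe' e' he', hDx]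
  · have hDx : 0 ≤ D (G.pathPoint n e i) := hD _
    rw [Finsupp.add_apply, hAσ, subdivDiv_pathPoint G n σ e (by omega) (by omega)]
    rw [hσe _ (by omega), hσe _ (by omega), hσe _ (by omega), hg, hg, hg]
    push_cast
    omega

/-- The vertices of a graph determine the ranks of divisors on its subdivisions. -/
lemma subdivide_oldVertex_determining {α β : Type*} (G : Graph α β) [Finite V(G)] [Fintype E(G)]
    (hloop : G.Loopless) (n : E(G) → ℕ) (hn : ∀ e, 1 ≤ n e) (D : V(G.subdivide n) →₀ ℤ)
    (h : ∀ v, ∃ E, 0 ≤ E ∧ E - D ∈ G.subdivPrincipal n ∧ 1 ≤ E (G.oldVertex n v))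
    (x : V(G.subdivide n)) :
    ∃ E, 0 ≤ E ∧ E - D ∈ G.subdivPrincipal n ∧ 1 ≤ E x := by
  rcases exists_eq_of_vertex_subdivide G n x with ⟨v, rfl⟩ | ⟨e, i, h0, hi, rfl⟩
  · exact h v
  obtain ⟨D₁, hD₁, hDD₁, hu⟩ := h (G.src e)
  obtain ⟨D₂, hD₂, hDD₂, hv⟩ := h (G.tgt e)
  obtain ⟨σ, hσ⟩ : D₂ - D₁ ∈ G.subdivPrincipal n := by
    have := sub_mem hDD₂ hDD₁
    simpa using this
  change ∀ x, (D₂ - D₁) x = G.subdivDiv n σ x at hσ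
  set c := σ (G.pathPoint n e i) with hc
  -- Truncating `σ` at its value at the target vertex: `D₁ + A` dominates `D₁` where `σ ≤ c` and
  -- `D₂` where `c ≤ σ`, hence is effective.
  obtain ⟨τ, hτ⟩ : ∃ τ : V(G.subdivide n) → ℤ, ∀ x, τ x = max (σ x) c := ⟨_, fun _ => rfl⟩
  obtain ⟨A, hA, hAτ⟩ := exists_mem_principal (ι := Σ e : E(G), Fin (n e))
    (fun a => G.pathPoint n a.1 a.2) (fun a => G.pathPoint n a.1 (a.2 + 1)) τ
  change ∀ x, A x = G.subdivDiv n τ x at hAτ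
  have hle : ∀ x, σ x ≤ c → D₁ x ≤ (D₁ + A) x := by
    intro x hx
    have := G.subdivDiv_mono n (σ := fun _ => c) (τ := τ) (x := x)
      (fun y => by change c ≤ τ y; rw [hτ]; exact le_max_right _ _) (by rw [hτ, max_eq_right hx])
    rw [show G.subdivDiv n (fun _ => c) x = 0 from edgeDiv_const _ _ _ _] at this
    rw [Finsupp.add_apply, hAτ]
    omega
  have hge : ∀ x, c ≤ σ x → D₂ x ≤ (D₁ + A) x := by
    intro x hx
    have := G.subdivDiv_mono n (σ := σ) (τ := τ) (x := x)
      (fun y => by rw [hτ]; exact le_max_left _ _) (by rw [hτ, max_eq_left hx])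
    have h2 := hσ x
    rw [Finsupp.sub_apply] at h2
    rw [Finsupp.add_apply, hAτ]
    omega
  have hnonneg : 0 ≤ D₁ + A := fun x => by
    rcases le_total (σ x) c with hx | hx
    · exact (hD₁ x).trans (hle x hx)
    · exact (hD₂ x).trans (hge x hx)
  -- Without a chip at `j`, both `D₁` and `D₂` vanish there, and so do the second differences of `τ`
  -- and `σ`. The first forces both neighbours to have `σ ≤ c`, the second then forces equality.
  have hstep : ∀ j, 0 < j → j < n e → σ (G.pathPoint n e j) = c →
      (D₁ + A) (G.pathPoint n e j) < 1 →
      σ (G.pathPoint n e (j + 1)) = c ∧ σ (G.pathPoint n e (j - 1)) = c := by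
    intro j h0 hj hjc hchip
    have h1 := hle _ hjc.le
    have h2 := hge _ hjc.ge
    have h3 : 0 ≤ D₁ (G.pathPoint n e j) := hD₁ _
    have h4 : 0 ≤ D₂ (G.pathPoint n e j) := hD₂ _
    have h5 := hσ (G.pathPoint n e j)
    have h6 := hAτ (G.pathPoint n e j)
    rw [subdivDiv_pathPoint G n _ e h0 hj] at h5 h6
    rw [hτ, hτ, hτ] at h6
    rw [Finsupp.sub_apply] at h5
    rw [Finsupp.add_apply] at h1 h2 hchip
    omega
  -- Otherwise the level `c` spreads along the path to the target of `e`, where the chip of `D₂`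
  -- survives in `D₁ + A`.
  have hright : ∃ b, i ≤ b ∧ b ≤ n e ∧ 1 ≤ (D₁ + A) (G.pathPoint n e b) := by
    by_contra! hno
    have : ∀ j, i ≤ j → j ≤ n e → σ (G.pathPoint n e j) = c := by
      intro j hij
      induction j, hij using Nat.le_induction with
      | base => exact fun _ => rfl
      | succ j hij ih =>
        intro hj
        exact (hstep j (by omega) (by omega) (ih (by omega)) (hno j hij (by omega))).1
    have h1 := hno (n e) hi.le le_rfl
    have h2 := hge _ (this (n e) hi.le le_rfl).ge
    rw [pathPoint_of_le G n e (hn e) le_rfl] at h1 h2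
    omega
  -- Likewise towards the source, where the chip of `D₁` survives.
  have hleft : ∃ a, a ≤ i ∧ 1 ≤ (D₁ + A) (G.pathPoint n e a) := by
    by_contra! hno
    have : ∀ k, k ≤ i → σ (G.pathPoint n e (i - k)) = c := by
      intro k
      induction k with
      | zero => exact fun _ => rfl
      | succ k ih =>
        intro hk
        exact (hstep (i - k) (by omega) (by omega) (ih (by omega)) (hno _ (by omega))).2
    have h1 := hno 0 (Nat.zero_le _)
    have h2 := this i le_rfl
    rw [Nat.sub_self] at h2
    have h3 := hle _ h2.le
    rw [pathPoint_zero] at h1 h3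
    omega
  obtain ⟨b, hib, hb, hDb⟩ := hright
  obtain ⟨a, hai, hDa⟩ := hleft
  obtain ⟨E, hE, hDE, hEi⟩ :=
    exists_chip_of_chips_on_path G hloop n hn hnonneg e hai hib hb hDa hDb
  refine ⟨E, hE, ?_, hEi⟩
  have := add_mem (add_mem hDE hA) hDD₁
  convert this using 1
  abel

lemma subdivide_rankGE {α β : Type*} (G : Graph α β) [Finite V(G)] [Fintype E(G)]
    (hloop : G.Loopless) (n : E(G) → ℕ) (hn : ∀ e, 1 ≤ n e) {k : ℕ} {D : V(G.subdivide n) →₀ ℤ}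
    (h : ∀ l : List V(G), l.length = k →
      (linearSystem (G.subdivide n).DivEquiv
        (D - listDivisor (l.map (G.oldVertex n)))).Nonempty) :
    RankGE (G.subdivide n).DivEquiv k D := by
  refine rankGE_of_determining (G.oldVertex n) (fun D hD x => ?_) h
  have hR := G.subdivide_divEquiv_iff hloop n
  simp only [linearSystem_sub_single_nonempty hR] at hD ⊢
  exact subdivide_oldVertex_determining G hloop n hn D hD x

/-- With `r` chips on every vertex, subtracting any effective divisor of degree `r` leaves an
effective divisor. This provides a candidate for each minimum. -/
lemma rankGE_smul_sum {α β : Type*} (G : Graph α β) [Fintype V(G)] (r : ℕ) :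
    RankGE G.DivEquiv r (∑ v : V(G), Finsupp.single v (r : ℤ)) := by
  intro F hF hr
  refine ⟨(∑ v : V(G), Finsupp.single v (r : ℤ)) - F, ?_, ⟨fun _ => 0, fun v => by simp⟩⟩
  intro v
  have hFv : F v ≤ r := by
    rw [← hr, Finsupp.degree_eq_sum]
    exact Finset.single_le_sum (fun i _ => hF i) (Finset.mem_univ v)
  simp only [Finsupp.coe_zero, Pi.zero_apply, Finsupp.sub_apply, Finsupp.finsetSum_apply]
  rw [Finset.sum_eq_single v]
  · simpa using hFv
  · intro w _ hw
    simp [hw]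
  · simp

end Graph

/-! ### Piecewise linear functions on the real line -/

namespace PiecewiseLinear

open Filter Topology

/-- `m` is the slope of `g` at `t` in the positive direction. -/
def SlopeR (g : ℝ → ℝ) (t : ℝ) (m : ℤ) : Prop := ∀ᶠ s in 𝓝[>] t, g s = g t + m * (s - t)

/-- `m` is the slope of `g` at `t` in the negative direction. -/
def SlopeL (g : ℝ → ℝ) (t : ℝ) (m : ℤ) : Prop := ∀ᶠ s in 𝓝[<] t, g s = g t + m * (t - s)

/-- Functions that are locally piecewise linear with integer slopes. -/
def IsPL (g : ℝ → ℝ) : Prop := ∀ t, (∃ m, SlopeR g t m) ∧ ∃ m, SlopeL g t m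

lemma SlopeR.derivWithin {g : ℝ → ℝ} {t : ℝ} {m : ℤ} (h : SlopeR g t m) :
    derivWithin g (Ici t) t = m := by
  have h1 : g =ᶠ[𝓝[≥] t] fun s => g t + m * (s - t) := by
    rw [Filter.EventuallyEq, ← Ioi_insert, nhdsWithin_insert, eventually_sup]
    exact ⟨by simp, h⟩
  have h2 : HasDerivAt (fun s => g t + m * (s - t)) m t := by
    simpa using (((hasDerivAt_id t).sub_const t).const_mul (m : ℝ)).const_add (g t)
  rw [h1.derivWithin_eq (by simp)]
  exact h2.hasDerivWithinAt.derivWithin (uniqueDiffWithinAt_Ici t)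

lemma SlopeL.derivWithin {g : ℝ → ℝ} {t : ℝ} {m : ℤ} (h : SlopeL g t m) :
    -derivWithin g (Iic t) t = m := by
  have h1 : g =ᶠ[𝓝[≤] t] fun s => g t + m * (t - s) := by
    rw [Filter.EventuallyEq, ← Iio_insert, nhdsWithin_insert, eventually_sup]
    exact ⟨by simp, h⟩
  have h2 : HasDerivAt (fun s => g t + m * (t - s)) (-m) t := by
    simpa using (((hasDerivAt_id t).const_sub t).const_mul (m : ℝ)).const_add (g t)
  rw [h1.derivWithin_eq (by simp),
    h2.hasDerivWithinAt.derivWithin (uniqueDiffWithinAt_Iic t), neg_neg]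

lemma SlopeR.add {g h : ℝ → ℝ} {t : ℝ} {m m' : ℤ} (hg : SlopeR g t m) (hh : SlopeR h t m') :
    SlopeR (fun s => g s + h s) t (m + m') := by
  filter_upwards [hg, hh] with s h1 h2
  rw [h1, h2]; push_cast; ring

lemma SlopeL.add {g h : ℝ → ℝ} {t : ℝ} {m m' : ℤ} (hg : SlopeL g t m) (hh : SlopeL h t m') :
    SlopeL (fun s => g s + h s) t (m + m') := by
  filter_upwards [hg, hh] with s h1 h2
  rw [h1, h2]; push_cast; ring

lemma SlopeR.const_mul {g : ℝ → ℝ} {t : ℝ} {m : ℤ} (hg : SlopeR g t m) (k : ℤ) :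
    SlopeR (fun s => k * g s) t (k * m) := by
  filter_upwards [hg] with s h1
  rw [h1]; push_cast; ring

lemma SlopeL.const_mul {g : ℝ → ℝ} {t : ℝ} {m : ℤ} (hg : SlopeL g t m) (k : ℤ) :
    SlopeL (fun s => k * g s) t (k * m) := by
  filter_upwards [hg] with s h1
  rw [h1]; push_cast; ring

lemma slopeR_const (c t : ℝ) : SlopeR (fun _ => c) t 0 := by simp [SlopeR]

lemma slopeL_const (c t : ℝ) : SlopeL (fun _ => c) t 0 := by simp [SlopeL]

lemma slopeR_id (t : ℝ) : SlopeR (fun s => s) t 1 := by simp [SlopeR]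

lemma slopeL_id (t : ℝ) : SlopeL (fun s => s) t (-1) := by simp [SlopeL]

lemma SlopeR.congr {g h : ℝ → ℝ} {t : ℝ} {m : ℤ} (hg : SlopeR g t m) (heq : g =ᶠ[𝓝[>] t] h)
    (ht : g t = h t) : SlopeR h t m := by
  filter_upwards [hg, heq] with s h1 h2
  rw [← h2, h1, ht]

lemma SlopeL.congr {g h : ℝ → ℝ} {t : ℝ} {m : ℤ} (hg : SlopeL g t m) (heq : g =ᶠ[𝓝[<] t] h)
    (ht : g t = h t) : SlopeL h t m := by
  filter_upwards [hg, heq] with s h1 h2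
  rw [← h2, h1, ht]

/-- The continuous counterpart of `edgeDiv_mono`, one direction at a time. -/
lemma SlopeR.mono {g h : ℝ → ℝ} {t : ℝ} {m m' : ℤ} (hg : SlopeR g t m) (hh : SlopeR h t m')
    (hle : g ≤ h) (ht : g t = h t) : m ≤ m' := by
  obtain ⟨s, ⟨h1, h2⟩, hs⟩ := ((hg.and hh).and self_mem_nhdsWithin).exists
  have h3 := hle s
  rw [h1, h2, ht] at h3
  have h4 : 0 < s - t := sub_pos.2 hs
  have : (m : ℝ) ≤ m' := le_of_mul_le_mul_right (by linarith) h4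
  exact_mod_cast this

lemma SlopeL.mono {g h : ℝ → ℝ} {t : ℝ} {m m' : ℤ} (hg : SlopeL g t m) (hh : SlopeL h t m')
    (hle : g ≤ h) (ht : g t = h t) : m ≤ m' := by
  obtain ⟨s, ⟨h1, h2⟩, hs⟩ := ((hg.and hh).and self_mem_nhdsWithin).exists
  have h3 := hle s
  rw [h1, h2, ht] at h3
  have h4 : 0 < t - s := sub_pos.2 hs
  have : (m : ℝ) ≤ m' := le_of_mul_le_mul_right (by linarith) h4
  exact_mod_cast this

lemma SlopeR.tendsto {g : ℝ → ℝ} {t : ℝ} {m : ℤ} (hg : SlopeR g t m) :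
    Tendsto g (𝓝[>] t) (𝓝 (g t)) := by
  have : Tendsto (fun s => g t + m * (s - t)) (𝓝[>] t) (𝓝 (g t)) := by
    have : Continuous fun s => g t + m * (s - t) := by fun_prop
    simpa using (this.tendsto t).mono_left nhdsWithin_le_nhds
  exact this.congr' (Eventually.mono hg fun s h => h.symm)

lemma SlopeL.tendsto {g : ℝ → ℝ} {t : ℝ} {m : ℤ} (hg : SlopeL g t m) :
    Tendsto g (𝓝[<] t) (𝓝 (g t)) := by
  have : Tendsto (fun s => g t + m * (t - s)) (𝓝[<] t) (𝓝 (g t)) := by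
    have : Continuous fun s => g t + m * (t - s) := by fun_prop
    simpa using (this.tendsto t).mono_left nhdsWithin_le_nhds
  exact this.congr' (Eventually.mono hg fun s h => h.symm)

lemma SlopeR.max_left {g h : ℝ → ℝ} {t : ℝ} {m m' : ℤ} (hg : SlopeR g t m) (hh : SlopeR h t m')
    (hlt : h t < g t) : SlopeR (fun s => max (g s) (h s)) t m := by
  refine hg.congr ?_ (max_eq_left hlt.le).symm
  filter_upwards [hh.tendsto.eventually_lt hg.tendsto hlt] with s hs
  exact (max_eq_left hs.le).symm

lemma SlopeL.max_left {g h : ℝ → ℝ} {t : ℝ} {m m' : ℤ} (hg : SlopeL g t m) (hh : SlopeL h t m')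
    (hlt : h t < g t) : SlopeL (fun s => max (g s) (h s)) t m := by
  refine hg.congr ?_ (max_eq_left hlt.le).symm
  filter_upwards [hh.tendsto.eventually_lt hg.tendsto hlt] with s hs
  exact (max_eq_left hs.le).symm

lemma SlopeR.max_of_eq {g h : ℝ → ℝ} {t : ℝ} {m m' : ℤ} (hg : SlopeR g t m) (hh : SlopeR h t m')
    (heq : h t = g t) : SlopeR (fun s => max (g s) (h s)) t (max m m') := by
  filter_upwards [hg, hh, self_mem_nhdsWithin] with s h1 h2 hs
  have h3 : 0 ≤ s - t := (sub_pos.2 hs).le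
  rw [h1, h2, heq, max_self, max_add_add_left, ← max_mul_of_nonneg _ _ h3]
  push_cast
  rfl

lemma SlopeL.max_of_eq {g h : ℝ → ℝ} {t : ℝ} {m m' : ℤ} (hg : SlopeL g t m) (hh : SlopeL h t m')
    (heq : h t = g t) : SlopeL (fun s => max (g s) (h s)) t (max m m') := by
  filter_upwards [hg, hh, self_mem_nhdsWithin] with s h1 h2 hs
  have h3 : 0 ≤ t - s := (sub_pos.2 hs).le
  rw [h1, h2, heq, max_self, max_add_add_left, ← max_mul_of_nonneg _ _ h3]
  push_cast
  rfl

lemma IsPL.add {g h : ℝ → ℝ} (hg : IsPL g) (hh : IsPL h) : IsPL fun s => g s + h s := fun t => by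
  obtain ⟨⟨m, hm⟩, ⟨k, hk⟩⟩ := hg t
  obtain ⟨⟨m', hm'⟩, ⟨k', hk'⟩⟩ := hh t
  exact ⟨⟨_, hm.add hm'⟩, ⟨_, hk.add hk'⟩⟩

lemma IsPL.const_mul {g : ℝ → ℝ} (hg : IsPL g) (k : ℤ) : IsPL fun s => k * g s := fun t => by
  obtain ⟨⟨m, hm⟩, ⟨m', hm'⟩⟩ := hg t
  exact ⟨⟨_, hm.const_mul k⟩, ⟨_, hm'.const_mul k⟩⟩

lemma IsPL.neg {g : ℝ → ℝ} (hg : IsPL g) : IsPL fun s => -g s := by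
  simpa using hg.const_mul (-1)

lemma isPL_const (c : ℝ) : IsPL fun _ => c := fun t => ⟨⟨_, slopeR_const c t⟩, ⟨_, slopeL_const c t⟩⟩

lemma isPL_id : IsPL fun s => s := fun t => ⟨⟨_, slopeR_id t⟩, ⟨_, slopeL_id t⟩⟩

lemma IsPL.max {g h : ℝ → ℝ} (hg : IsPL g) (hh : IsPL h) : IsPL fun s => max (g s) (h s) := by
  intro t
  obtain ⟨⟨m, hm⟩, ⟨k, hk⟩⟩ := hg t
  obtain ⟨⟨m', hm'⟩, ⟨k', hk'⟩⟩ := hh t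
  rcases lt_trichotomy (h t) (g t) with hlt | heq | hlt
  · exact ⟨⟨_, hm.max_left hm' hlt⟩, ⟨_, hk.max_left hk' hlt⟩⟩
  · exact ⟨⟨_, hm.max_of_eq hm' heq⟩, ⟨_, hk.max_of_eq hk' heq⟩⟩
  · simp_rw [max_comm (g _)]
    exact ⟨⟨_, hm'.max_left hm hlt⟩, ⟨_, hk'.max_left hk hlt⟩⟩

lemma IsPL.min {g h : ℝ → ℝ} (hg : IsPL g) (hh : IsPL h) : IsPL fun s => min (g s) (h s) := by
  have := (hg.neg.max hh.neg).neg
  simpa [max_neg_neg] using this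

lemma IsPL.continuous {g : ℝ → ℝ} (hg : IsPL g) : Continuous g := by
  rw [continuous_iff_continuousAt]
  intro t
  obtain ⟨⟨m, hm⟩, ⟨k, hk⟩⟩ := hg t
  rw [continuousAt_iff_continuous_left'_right']
  exact ⟨hk.tendsto, hm.tendsto⟩

/-- `g` is linear with an integer slope on all intervals inside `[x, y]` that have no element of
`S` in their interior. -/
def LinearOffOn (g : ℝ → ℝ) (S : Finset ℝ) (x y : ℝ) : Prop :=
  ∀ a b : ℝ, x ≤ a → a < b → b ≤ y → (∀ s ∈ S, s ∉ Ioo a b) →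
    ∃ (m : ℤ) (c : ℝ), ∀ t ∈ Icc a b, g t = m * t + c

lemma LinearOffOn.trans {g : ℝ → ℝ} {S T : Finset ℝ} {x y z : ℝ} (h : LinearOffOn g S x y)
    (h' : LinearOffOn g T y z) : ∃ U, LinearOffOn g U x z := by
  classical
  refine ⟨insert y (S ∪ T), fun a b ha hab hb hU => ?_⟩
  have hy := hU y (Finset.mem_insert_self _ _)
  rw [mem_Ioo, not_and_or, not_lt, not_lt] at hy
  rcases hy with hy | hy
  · exact h' a b hy hab hb fun s hs =>
      hU s (Finset.mem_insert_of_mem (Finset.mem_union_right _ hs))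
  · exact h a b ha hab hy fun s hs =>
      hU s (Finset.mem_insert_of_mem (Finset.mem_union_left _ hs))

lemma IsPL.exists_linearOffOn_nhds {g : ℝ → ℝ} (hg : IsPL g) (t : ℝ) :
    ∃ u v, u < t ∧ t < v ∧ ∀ x y, u < x → y < v → LinearOffOn g {t} x y := by
  obtain ⟨⟨m, hm⟩, ⟨k, hk⟩⟩ := hg t
  obtain ⟨v, hv, hvm⟩ := (mem_nhdsGT_iff_exists_Ioo_subset).1 hm
  obtain ⟨u, hu, huk⟩ := (mem_nhdsLT_iff_exists_Ioo_subset).1 hk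
  refine ⟨u, v, hu, hv, fun x y hx hy a b ha hab hb ht => ?_⟩
  have ht := ht t (Finset.mem_singleton_self t)
  rw [mem_Ioo, not_and_or, not_lt, not_lt] at ht
  rcases ht with ht | ht
  · refine ⟨m, g t - m * t, fun s hs => ?_⟩
    rcases (ht.trans hs.1).eq_or_lt with rfl | hts
    · ring
    · rw [show g s = g t + m * (s - t) from hvm ⟨hts, by linarith [hs.2]⟩]
      ring
  · refine ⟨-k, g t + k * t, fun s hs => ?_⟩
    rcases (hs.2.trans ht).eq_or_lt with rfl | hts
    · push_cast
      ring
    · rw [show g s = g t + k * (t - s) from huk ⟨by linarith [hs.1], hts⟩]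
      push_cast
      ring

/-- Compactness: finitely many of the local neighbourhoods cover `[x, y]`, and the break points of
consecutive pieces are collected together with the joints. -/
lemma IsPL.exists_linearOffOn {g : ℝ → ℝ} (hg : IsPL g) {x y : ℝ} (hxy : x ≤ y) :
    ∃ S, LinearOffOn g S x y := by
  choose u v hu hv huv using hg.exists_linearOffOn_nhds
  obtain ⟨t, ht0, -, ⟨n, hn⟩, htc⟩ := exists_monotone_Icc_subset_open_cover_Icc hxy
    (c := fun i : ℝ => {z : Icc x y | (z : ℝ) ∈ Ioo (u i) (v i)})
    (fun i => isOpen_Ioo.preimage continuous_subtype_val)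
    (fun z _ => mem_iUnion.2 ⟨z, hu z, hv z⟩)
  have key : ∀ k, ∃ S, LinearOffOn g S x (t k) := by
    intro k
    induction k with
    | zero =>
      rw [ht0]
      exact ⟨∅, fun a b ha hab hb => by linarith⟩
    | succ k ih =>
      obtain ⟨S, hS⟩ := ih
      rcases le_or_gt (t k) (t (k + 1)) with hle | hlt
      · obtain ⟨i, hi⟩ := htc k
        exact hS.trans (huv i (t k) (t (k + 1)) (hi ⟨le_rfl, hle⟩).1 (hi ⟨hle, le_rfl⟩).2)
      · exact ⟨S, fun a b ha hab hb => hS a b ha hab (hb.trans (Subtype.coe_le_coe.2 hlt.le))⟩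
  obtain ⟨S, hS⟩ := key n
  rw [hn n le_rfl] at hS
  exact ⟨S, hS⟩

lemma exists_pos_forall_notMem (S : Finset ℝ) (t : ℝ) :
    ∃ ε > 0, ∀ s ∈ S, s ∉ Ioo (t - ε) t ∧ s ∉ Ioo t (t + ε) := by
  have : (↑(S.erase t) : Set ℝ)ᶜ ∈ 𝓝 t :=
    (S.erase t).finite_toSet.isClosed.isOpen_compl.mem_nhds (by simp)
  obtain ⟨ε, hε, hb⟩ := Metric.mem_nhds_iff.1 this
  refine ⟨ε, hε, fun s hs => ⟨fun h => ?_, fun h => ?_⟩⟩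
  · refine hb (a := s) ?_ (Finset.mem_coe.2 (Finset.mem_erase.2 ⟨h.2.ne, hs⟩))
    rw [Metric.mem_ball, Real.dist_eq, abs_lt]
    constructor <;> linarith [h.1, h.2]
  · refine hb (a := s) ?_ (Finset.mem_coe.2 (Finset.mem_erase.2 ⟨h.1.ne', hs⟩))
    rw [Metric.mem_ball, Real.dist_eq, abs_lt]
    constructor <;> linarith [h.1, h.2]

lemma slopeR_of_linear {g : ℝ → ℝ} {a b c : ℝ} {m : ℤ} (hab : a < b)
    (h : ∀ t ∈ Icc a b, g t = m * t + c) : SlopeR g a m := by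
  filter_upwards [Ioo_mem_nhdsGT hab] with s hs
  rw [h s ⟨hs.1.le, hs.2.le⟩, h a ⟨le_rfl, hab.le⟩]
  ring

lemma slopeL_of_linear {g : ℝ → ℝ} {a b c : ℝ} {m : ℤ} (hab : a < b)
    (h : ∀ t ∈ Icc a b, g t = m * t + c) : SlopeL g b (-m) := by
  filter_upwards [Ioo_mem_nhdsLT hab] with s hs
  rw [h s ⟨hs.1.le, hs.2.le⟩, h b ⟨hab.le, le_rfl⟩]
  push_cast
  ring

lemma LinearOffOn.exists_slopeR {g : ℝ → ℝ} {S : Finset ℝ} {x y t : ℝ} (h : LinearOffOn g S x y)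
    (hx : x ≤ t) (hy : t < y) : ∃ m, SlopeR g t m := by
  obtain ⟨ε, hε, hS⟩ := exists_pos_forall_notMem S t
  have hlt : t < min y (t + ε) := lt_min hy (by linarith)
  obtain ⟨m, c, hm⟩ := h t (min y (t + ε)) hx hlt (min_le_left _ _)
    fun s hs hs' => (hS s hs).2 ⟨hs'.1, hs'.2.trans_le (min_le_right _ _)⟩
  exact ⟨m, slopeR_of_linear hlt hm⟩

lemma LinearOffOn.exists_slopeL {g : ℝ → ℝ} {S : Finset ℝ} {x y t : ℝ} (h : LinearOffOn g S x y)
    (hx : x < t) (hy : t ≤ y) : ∃ m, SlopeL g t m := by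
  obtain ⟨ε, hε, hS⟩ := exists_pos_forall_notMem S t
  have hlt : max x (t - ε) < t := max_lt hx (by linarith)
  obtain ⟨m, c, hm⟩ := h (max x (t - ε)) t (le_max_left _ _) hlt hy
    fun s hs hs' => (hS s hs).1 ⟨(le_max_right _ _).trans_lt hs'.1, hs'.2⟩
  exact ⟨-m, slopeL_of_linear hlt hm⟩

lemma LinearOffOn.exists_slopes_opposite {g : ℝ → ℝ} {S : Finset ℝ} {x y t : ℝ}
    (h : LinearOffOn g S x y) (hx : x < t) (hy : t < y) (ht : t ∉ S) :
    ∃ m, SlopeR g t m ∧ SlopeL g t (-m) := by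
  obtain ⟨ε, hε, hS⟩ := exists_pos_forall_notMem S t
  have hlt : max x (t - ε) < t := max_lt hx (by linarith)
  have hlt' : t < min y (t + ε) := lt_min hy (by linarith)
  obtain ⟨m, c, hm⟩ := h (max x (t - ε)) (min y (t + ε)) (le_max_left _ _) (hlt.trans hlt')
    (min_le_left _ _) (fun s hs hs' => by
      rcases lt_trichotomy s t with hst | rfl | hst
      · exact (hS s hs).1 ⟨(le_max_right _ _).trans_lt hs'.1, hst⟩
      · exact ht hs
      · exact (hS s hs).2 ⟨hst, hs'.2.trans_le (min_le_right _ _)⟩)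
  exact ⟨m, slopeR_of_linear hlt' fun s hs => hm s ⟨hlt.le.trans hs.1, hs.2⟩,
    slopeL_of_linear hlt fun s hs => hm s ⟨hs.1, hs.2.trans hlt'.le⟩⟩

lemma isPL_of_linearOffOn {g : ℝ → ℝ} {S : Finset ℝ} {x y : ℝ}
    (h : LinearOffOn g S x y) (hx : ∀ t ≤ x, g t = g x) (hy : ∀ t, y ≤ t → g t = g y) :
    IsPL g := by
  intro t
  constructor
  · rcases lt_or_ge t x with htx | htx
    · refine ⟨0, ?_⟩
      filter_upwards [Ioo_mem_nhdsGT htx] with s hs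
      rw [hx s hs.2.le, hx t htx.le]
      simp
    · rcases lt_or_ge t y with hty | hty
      · exact h.exists_slopeR htx hty
      · refine ⟨0, ?_⟩
        filter_upwards [self_mem_nhdsWithin] with s hs
        rw [hy s (hty.trans (mem_Ioi.1 hs).le), hy t hty]
        simp
  · rcases lt_or_ge y t with hty | hty
    · refine ⟨0, ?_⟩
      filter_upwards [Ioo_mem_nhdsLT hty] with s hs
      rw [hy s hs.1.le, hy t hty.le]
      simp
    · rcases lt_or_ge x t with htx | htx
      · exact h.exists_slopeL htx hty
      · refine ⟨0, ?_⟩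
        filter_upwards [self_mem_nhdsWithin] with s hs
        rw [hx s ((mem_Iio.1 hs).le.trans htx), hx t htx]
        simp

/-- The slope of a piecewise linear function in the positive direction. -/
noncomputable def slopeR (g : ℝ → ℝ) (t : ℝ) : ℤ := ⌊derivWithin g (Ici t) t⌋

/-- The slope of a piecewise linear function in the negative direction. -/
noncomputable def slopeL (g : ℝ → ℝ) (t : ℝ) : ℤ := ⌊-derivWithin g (Iic t) t⌋

/-- The floor in `slopeR` only serves to land in `ℤ`: the derivative is already an integer here. -/
lemma SlopeR.eq {g : ℝ → ℝ} {t : ℝ} {m : ℤ} (h : SlopeR g t m) : slopeR g t = m := by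
  rw [slopeR, h.derivWithin, Int.floor_intCast]

lemma SlopeL.eq {g : ℝ → ℝ} {t : ℝ} {m : ℤ} (h : SlopeL g t m) : slopeL g t = m := by
  rw [slopeL, h.derivWithin, Int.floor_intCast]

lemma IsPL.slopeR {g : ℝ → ℝ} (h : IsPL g) (t : ℝ) : SlopeR g t (slopeR g t) := by
  obtain ⟨m, hm⟩ := (h t).1
  rwa [hm.eq]

lemma IsPL.slopeL {g : ℝ → ℝ} (h : IsPL g) (t : ℝ) : SlopeL g t (slopeL g t) := by
  obtain ⟨m, hm⟩ := (h t).2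
  rwa [hm.eq]

end PiecewiseLinear

/-! ### Rational functions and principal divisors on a metric graph -/

namespace MetricGraph

open PiecewiseLinear

lemma edgePath_of_nonpos {α β : Type*} {G : Graph α β} {ℓ : E(G) → ℝ} (e : E(G)) {t : ℝ}
    (ht : t ≤ 0) : (edgePath e t : MetricGraph G ℓ) = vertex (G.src e) := by
  simp [edgePath, ht]

lemma edgePath_of_mem {α β : Type*} {G : Graph α β} {ℓ : E(G) → ℝ} (e : E(G)) {t : ℝ}
    (ht : t ∈ Ioo 0 (ℓ e)) : (edgePath e t : MetricGraph G ℓ) = edgePoint e ⟨t, ht⟩ := by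
  simp [edgePath, ht.1.not_ge, ht.2]

lemma edgePath_of_le {α β : Type*} {G : Graph α β} {ℓ : E(G) → ℝ} (e : E(G)) {t : ℝ}
    (h0 : 0 < ℓ e) (ht : ℓ e ≤ t) : (edgePath e t : MetricGraph G ℓ) = vertex (G.tgt e) := by
  simp [edgePath, (h0.trans_le ht).not_ge, ht.not_gt]

lemma continuous_of_edgePath {α β : Type*} {G : Graph α β} {ℓ : E(G) → ℝ}
    {f : MetricGraph G ℓ → ℝ} (h : ∀ e, Continuous fun t => f (edgePath e t)) :
    Continuous f :=
  continuous_iSup_dom.2 fun e => continuous_coinduced_dom.2 (h e)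

/-- Since `edgePath` is constant beyond the ends of the edge, rationality becomes a local condition
on functions on `ℝ`, which is easily seen to be stable under sums and maxima. Finiteness of the
break points comes back by compactness, and global continuity from the gluing topology. -/
lemma isRational_iff {α β : Type*} {G : Graph α β} {ℓ : E(G) → ℝ} (hℓ : ∀ e, 0 < ℓ e)
    {f : MetricGraph G ℓ → ℝ} : IsRational f ↔ ∀ e, IsPL fun t => f (edgePath e t) := by
  constructor
  · rintro ⟨-, h⟩ e
    obtain ⟨S, hS⟩ := h e
    refine isPL_of_linearOffOn (S := S) (x := 0) (y := ℓ e) hS ?_ ?_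
    · intro t ht
      simp [edgePath_of_nonpos e ht, edgePath_of_nonpos e le_rfl]
    · intro t ht
      simp [edgePath_of_le e (hℓ e) ht, edgePath_of_le e (hℓ e) le_rfl]
  · intro h
    exact ⟨continuous_of_edgePath fun e => (h e).continuous,
      fun e => (h e).exists_linearOffOn (hℓ e).le⟩

open Classical in
/-- The order of a rational function at a point, as an integer. -/
noncomputable def ordInt {α β : Type*} {G : Graph α β} [Fintype E(G)] {ℓ : E(G) → ℝ}
    (f : MetricGraph G ℓ → ℝ) : MetricGraph G ℓ → ℤ
  | vertex v => ∑ e : E(G), ((if G.src e = v then slopeR (fun s => f (edgePath e s)) 0 else 0) +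
      (if G.tgt e = v then slopeL (fun s => f (edgePath e s)) (ℓ e) else 0))
  | edgePoint e t => slopeR (fun s => f (edgePath e s)) t + slopeL (fun s => f (edgePath e s)) t

lemma ord_eq_ordInt {α β : Type*} {G : Graph α β} [Fintype E(G)] {ℓ : E(G) → ℝ}
    (hℓ : ∀ e, 0 < ℓ e) {f : MetricGraph G ℓ → ℝ} (hf : IsRational f) (p : MetricGraph G ℓ) :
    ord f p = ordInt f p := by
  rw [isRational_iff hℓ] at hf
  cases p with
  | vertex v =>
    simp only [ord, ordInt]
    rw [finsum_eq_sum_of_fintype, Int.cast_sum]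
    refine Finset.sum_congr rfl fun e _ => ?_
    rw [((hf e).slopeR 0).derivWithin, ((hf e).slopeL (ℓ e)).derivWithin]
    push_cast
    rfl
  | edgePoint e t =>
    simp only [ord, ordInt]
    rw [((hf e).slopeR t).derivWithin, ((hf e).slopeL t).derivWithin]
    push_cast
    rfl

lemma IsRational.add {α β : Type*} {G : Graph α β} {ℓ : E(G) → ℝ}
    (hℓ : ∀ e, 0 < ℓ e) {f g : MetricGraph G ℓ → ℝ} (hf : IsRational f) (hg : IsRational g) :
    IsRational fun p => f p + g p := by
  rw [isRational_iff hℓ] at *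
  exact fun e => (hf e).add (hg e)

lemma IsRational.neg {α β : Type*} {G : Graph α β} {ℓ : E(G) → ℝ}
    (hℓ : ∀ e, 0 < ℓ e) {f : MetricGraph G ℓ → ℝ} (hf : IsRational f) :
    IsRational fun p => -f p := by
  rw [isRational_iff hℓ] at *
  exact fun e => (hf e).neg

lemma IsRational.max {α β : Type*} {G : Graph α β} {ℓ : E(G) → ℝ}
    (hℓ : ∀ e, 0 < ℓ e) {f g : MetricGraph G ℓ → ℝ} (hf : IsRational f) (hg : IsRational g) :
    IsRational fun p => max (f p) (g p) := by
  rw [isRational_iff hℓ] at *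
  exact fun e => (hf e).max (hg e)

lemma isRational_const {α β : Type*} {G : Graph α β} {ℓ : E(G) → ℝ}
    (hℓ : ∀ e, 0 < ℓ e) (c : ℝ) : IsRational fun _ : MetricGraph G ℓ => c := by
  rw [isRational_iff hℓ]
  exact fun e => isPL_const c

lemma ordInt_add {α β : Type*} {G : Graph α β} [Fintype E(G)] {ℓ : E(G) → ℝ}
    (hℓ : ∀ e, 0 < ℓ e) {f g : MetricGraph G ℓ → ℝ} (hf : IsRational f) (hg : IsRational g)
    (p : MetricGraph G ℓ) : ordInt (fun p => f p + g p) p = ordInt f p + ordInt g p := by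
  rw [isRational_iff hℓ] at hf hg
  have hR := fun e t => (((hf e).slopeR t).add ((hg e).slopeR t)).eq
  have hL := fun e t => (((hf e).slopeL t).add ((hg e).slopeL t)).eq
  cases p with
  | vertex v =>
    simp only [ordInt, hR, hL, ← Finset.sum_add_distrib]
    refine Finset.sum_congr rfl fun e _ => ?_
    split_ifs <;> ring
  | edgePoint e t =>
    simp only [ordInt, hR, hL]
    ring

lemma ordInt_const {α β : Type*} {G : Graph α β} [Fintype E(G)] {ℓ : E(G) → ℝ} (c : ℝ)
    (p : MetricGraph G ℓ) : ordInt (fun _ => c) p = 0 := by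
  cases p <;> simp [ordInt, (slopeR_const c _).eq, (slopeL_const c _).eq]

lemma ordInt_neg {α β : Type*} {G : Graph α β} [Fintype E(G)] {ℓ : E(G) → ℝ}
    (hℓ : ∀ e, 0 < ℓ e) {f : MetricGraph G ℓ → ℝ} (hf : IsRational f)
    (p : MetricGraph G ℓ) : ordInt (fun p => -f p) p = -ordInt f p := by
  have := ordInt_add hℓ hf (hf.neg hℓ) p
  simp only [add_neg_cancel, ordInt_const] at this
  omega

lemma ordInt_mono {α β : Type*} {G : Graph α β} [Fintype E(G)] {ℓ : E(G) → ℝ}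
    (hℓ : ∀ e, 0 < ℓ e) {f g : MetricGraph G ℓ → ℝ} (hf : IsRational f) (hg : IsRational g)
    (hfg : f ≤ g) {p : MetricGraph G ℓ} (hp : f p = g p) : ordInt f p ≤ ordInt g p := by
  rw [isRational_iff hℓ] at hf hg
  have hR := fun e t (h : f (edgePath e t) = g (edgePath e t)) =>
    ((hf e).slopeR t).mono ((hg e).slopeR t) (fun s => hfg _) h
  have hL := fun e t (h : f (edgePath e t) = g (edgePath e t)) =>
    ((hf e).slopeL t).mono ((hg e).slopeL t) (fun s => hfg _) h
  cases p with
  | vertex v =>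
    refine Finset.sum_le_sum fun e _ => add_le_add ?_ ?_
    · split_ifs with h
      · refine hR e 0 ?_
        rwa [edgePath_of_nonpos e le_rfl, h]
      · exact le_rfl
    · split_ifs with h
      · refine hL e _ ?_
        rwa [edgePath_of_le e (hℓ e) le_rfl, h]
      · exact le_rfl
  | edgePoint e t =>
    rw [← edgePath_of_mem e t.2] at hp
    exact add_le_add (hR e t hp) (hL e t hp)

/-- The group of principal divisors on a metric graph. -/
noncomputable def principal {α β : Type*} (G : Graph α β) [Fintype E(G)] {ℓ : E(G) → ℝ}
    (hℓ : ∀ e, 0 < ℓ e) : AddSubgroup (MetricGraph G ℓ →₀ ℤ) where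
  carrier := {A | ∃ f : MetricGraph G ℓ → ℝ, IsRational f ∧ ∀ p, A p = ordInt f p}
  zero_mem' := ⟨fun _ => 0, isRational_const hℓ 0, fun p => by simp [ordInt_const]⟩
  add_mem' := by
    rintro A B ⟨f, hf, hA⟩ ⟨g, hg, hB⟩
    exact ⟨_, hf.add hℓ hg, fun p => by rw [ordInt_add hℓ hf hg, Finsupp.add_apply, hA, hB]⟩
  neg_mem' := by
    rintro A ⟨f, hf, hA⟩
    exact ⟨_, hf.neg hℓ, fun p => by rw [ordInt_neg hℓ hf, Finsupp.neg_apply, hA]⟩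

lemma divEquiv_iff {α β : Type*} (G : Graph α β) [Fintype E(G)] {ℓ : E(G) → ℝ}
    (hℓ : ∀ e, 0 < ℓ e) (D D' : MetricGraph G ℓ →₀ ℤ) :
    DivEquiv G ℓ D D' ↔ D' - D ∈ principal G hℓ := by
  refine exists_congr fun f => and_congr_right fun hf => forall_congr' fun p => ?_
  rw [ord_eq_ordInt hℓ hf, Finsupp.sub_apply]
  norm_cast
  constructor <;> intro h <;> omega

/-- The support is finite because at an interior point of an edge that is not a break point the two
outgoing slopes cancel. -/
lemma exists_mem_principal {α β : Type*} {G : Graph α β} [Finite V(G)] [Fintype E(G)]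
    {ℓ : E(G) → ℝ} (hℓ : ∀ e, 0 < ℓ e) {f : MetricGraph G ℓ → ℝ} (hf : IsRational f) :
    ∃ A ∈ principal G hℓ, ∀ p, A p = ordInt f p := by
  choose S hS using hf.2
  have hfin : (range (vertex : V(G) → MetricGraph G ℓ) ∪
      ⋃ e, (fun t => edgePath e t) '' (S e : Set ℝ)).Finite :=
    (finite_range _).union (finite_iUnion fun e => (S e).finite_toSet.image _)
  have hsupp : (Function.support (ordInt f)).Finite := by
    refine hfin.subset fun p hp => ?_
    cases p with
    | vertex v => exact Or.inl ⟨v, rfl⟩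
    | edgePoint e t =>
      refine Or.inr (mem_iUnion.2 ⟨e, t, ?_, edgePath_of_mem e t.2⟩)
      by_contra ht
      obtain ⟨m, hR, hL⟩ := LinearOffOn.exists_slopes_opposite (hS e) t.2.1 t.2.2 ht
      refine hp ?_
      simp [ordInt, hR.eq, hL.eq]
  exact ⟨Finsupp.ofSupportFinite _ hsupp, ⟨f, hf, fun _ => rfl⟩, fun _ => rfl⟩

end MetricGraph

/-! ### The function that moves two chips towards each other -/

namespace PiecewiseLinear

open Filter Topology

/-- The real analogue of the trapezoid in `exists_chip_of_chips_on_path`. Its slopes are never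
computed in full: `u`, `v` and the constant `-δ` lie below `g`, so touching them at a point bounds
the slopes of `g` from below there. -/
lemma exists_tent {a p b : ℝ} (hap : a < p) (hpb : p < b) :
    ∃ g : ℝ → ℝ, IsPL g ∧ (∀ t ≤ a, g t = 0) ∧ (∀ t, b ≤ t → g t = 0) ∧
      (∀ t, t ≠ a → t ≠ b → 0 ≤ slopeR g t + slopeL g t) ∧
      -1 ≤ slopeR g a ∧ -1 ≤ slopeL g b ∧ 1 ≤ slopeR g p + slopeL g p := by
  obtain ⟨δ, hδ⟩ : ∃ δ, δ = min (p - a) (b - p) := ⟨_, rfl⟩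
  obtain ⟨u, hu⟩ : ∃ u : ℝ → ℝ, u = fun t => min 0 (a + (-1 : ℤ) * t) := ⟨_, rfl⟩
  obtain ⟨v, hv⟩ : ∃ v : ℝ → ℝ, v = fun t => min 0 (t + -b) := ⟨_, rfl⟩
  obtain ⟨g, hg⟩ : ∃ g : ℝ → ℝ, g = fun t => max (max (u t) (v t)) (-δ) := ⟨_, rfl⟩
  have hδ0 : 0 < δ := by rw [hδ]; exact lt_min (by linarith) (by linarith)
  have hδ1 : δ ≤ p - a := by rw [hδ]; exact min_le_left _ _
  have hδ2 : δ ≤ b - p := by rw [hδ]; exact min_le_right _ _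
  have huPL : IsPL u := hu ▸ (isPL_const 0).min ((isPL_const a).add (isPL_id.const_mul (-1)))
  have hvPL : IsPL v := hv ▸ (isPL_const 0).min (isPL_id.add (isPL_const (-b)))
  have hgPL : IsPL g := hg ▸ (huPL.max hvPL).max (isPL_const (-δ))
  have hu0 : ∀ t ≤ a, u t = 0 := fun t ht => by
    rw [hu]; push_cast; exact min_eq_left (by linarith)
  have hu1 : ∀ t, a ≤ t → u t = a - t := fun t ht => by
    rw [hu]; push_cast; rw [min_eq_right (by linarith)]; ring
  have hv0 : ∀ t, b ≤ t → v t = 0 := fun t ht => by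
    rw [hv]; exact min_eq_left (by linarith)
  have hv1 : ∀ t ≤ b, v t = t - b := fun t ht => by
    rw [hv]; dsimp only; rw [min_eq_right (by linarith)]; ring
  have hu' : ∀ t, u t ≤ 0 := fun t => by rw [hu]; exact min_le_left _ _
  have hv' : ∀ t, v t ≤ 0 := fun t => by rw [hv]; exact min_le_left _ _
  have hug : u ≤ g := fun t => by rw [hg]; exact (le_max_left _ _).trans (le_max_left _ _)
  have hvg : v ≤ g := fun t => by rw [hg]; exact (le_max_right _ _).trans (le_max_left _ _)
  have hcg : (fun _ => -δ) ≤ g := fun t => by rw [hg]; exact le_max_right _ _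
  have hg0 : ∀ t, g t ≤ 0 := fun t => by
    rw [hg]; exact max_le (max_le (hu' t) (hv' t)) (by linarith)
  have hga : ∀ t ≤ a, g t = 0 := fun t ht =>
    le_antisymm (hg0 t) ((hu0 t ht).symm.le.trans (hug t))
  have hgb : ∀ t, b ≤ t → g t = 0 := fun t ht =>
    le_antisymm (hg0 t) ((hv0 t ht).symm.le.trans (hvg t))
  have huR : ∀ t, a ≤ t → SlopeR u t (-1) := fun t ht => by
    filter_upwards [self_mem_nhdsWithin] with s hs
    rw [hu1 t ht, hu1 s (ht.trans (mem_Ioi.1 hs).le)]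
    push_cast; ring
  have huL : ∀ t, a < t → SlopeL u t 1 := fun t ht => by
    filter_upwards [Ioo_mem_nhdsLT ht] with s hs
    rw [hu1 t ht.le, hu1 s hs.1.le]
    push_cast; ring
  have huR0 : ∀ t < a, SlopeR u t 0 := fun t ht => by
    filter_upwards [Ioo_mem_nhdsGT ht] with s hs
    rw [hu0 t ht.le, hu0 s hs.2.le]
    simp
  have huL0 : ∀ t ≤ a, SlopeL u t 0 := fun t ht => by
    filter_upwards [self_mem_nhdsWithin] with s hs
    rw [hu0 t ht, hu0 s ((mem_Iio.1 hs).le.trans ht)]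
    simp
  have hvL : ∀ t ≤ b, SlopeL v t (-1) := fun t ht => by
    filter_upwards [self_mem_nhdsWithin] with s hs
    rw [hv1 t ht, hv1 s ((mem_Iio.1 hs).le.trans ht)]
    push_cast; ring
  have hvR : ∀ t < b, SlopeR v t 1 := fun t ht => by
    filter_upwards [Ioo_mem_nhdsGT ht] with s hs
    rw [hv1 t ht.le, hv1 s hs.2.le]
    push_cast; ring
  have hvR0 : ∀ t, b ≤ t → SlopeR v t 0 := fun t ht => by
    filter_upwards [self_mem_nhdsWithin] with s hs
    rw [hv0 t ht, hv0 s (ht.trans (mem_Ioi.1 hs).le)]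
    simp
  have hvL0 : ∀ t, b < t → SlopeL v t 0 := fun t ht => by
    filter_upwards [Ioo_mem_nhdsLT ht] with s hs
    rw [hv0 t ht.le, hv0 s hs.1.le]
    simp
  refine ⟨g, hgPL, hga, hgb, fun t hta htb => ?_, ?_, ?_, ?_⟩
  · have hR := hgPL.slopeR t
    have hL := hgPL.slopeL t
    rcases lt_or_gt_of_ne hta with hta | hta
    · have heq : u t = g t := by rw [hga t hta.le, hu0 t hta.le]
      have h1 := (huR0 t hta).mono hR hug heq
      have h2 := (huL0 t hta.le).mono hL hug heq
      omega
    rcases lt_or_gt_of_ne htb with htb | htb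
    -- Strictly between `a` and `b` each of the three functions has opposite outgoing slopes, so
    -- whichever one `g` touches gives order at least `0`.
    · have : g t = u t ∨ g t = v t ∨ g t = -δ := by
        rw [hg]
        rcases max_choice (max (u t) (v t)) (-δ) with h | h
        · rcases max_choice (u t) (v t) with h' | h'
          · exact Or.inl (h.trans h')
          · exact Or.inr (Or.inl (h.trans h'))
        · exact Or.inr (Or.inr h)
      rcases this with h | h | h
      · have h1 := (huR t hta.le).mono hR hug h.symm
        have h2 := (huL t hta).mono hL hug h.symm
        omega
      · have h1 := (hvR t htb).mono hR hvg h.symm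
        have h2 := (hvL t htb.le).mono hL hvg h.symm
        omega
      · have h1 := (slopeR_const (-δ) t).mono hR hcg h.symm
        have h2 := (slopeL_const (-δ) t).mono hL hcg h.symm
        omega
    · have heq : v t = g t := by rw [hgb t htb.le, hv0 t htb.le]
      have h1 := (hvR0 t htb.le).mono hR hvg heq
      have h2 := (hvL0 t htb).mono hL hvg heq
      omega
  · exact (huR a le_rfl).mono (hgPL.slopeR a) hug (by rw [hga a le_rfl, hu0 a le_rfl])
  · exact (hvL b le_rfl).mono (hgPL.slopeL b) hvg (by rw [hgb b le_rfl, hv0 b le_rfl])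
  · have hgp : g p = -δ := by
      rw [hg]
      dsimp only
      rw [hu1 p hap.le, hv1 p hpb.le]
      exact max_eq_right (max_le (by linarith) (by linarith))
    have h1 := (slopeR_const (-δ) p).mono (hgPL.slopeR p) hcg hgp.symm
    have h2 := (slopeL_const (-δ) p).mono (hgPL.slopeL p) hcg hgp.symm
    -- At `p` the bottom meets one of the sloping sides; the constant bounds both slopes by `0`, and
    -- that side bounds one of them by `1`.
    rcases min_choice (p - a) (b - p) with h | h
    · have h3 := (huL p hap).mono (hgPL.slopeL p) hug (by rw [hu1 p hap.le, hgp, hδ, h]; ring)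
      omega
    · have h3 := (hvR p hpb).mono (hgPL.slopeR p) hvg (by rw [hv1 p hpb.le, hgp, hδ, h]; ring)
      omega

lemma slopeR_eq_zero_of_lt {g : ℝ → ℝ} {t a c : ℝ} (ht : t < a) (h : ∀ s ≤ a, g s = c) :
    slopeR g t = 0 := by
  refine SlopeR.eq ((slopeR_const c t).congr ?_ (h t ht.le).symm)
  filter_upwards [Ioo_mem_nhdsGT ht] with s hs
  exact (h s hs.2.le).symm

lemma slopeL_eq_zero_of_gt {g : ℝ → ℝ} {t a c : ℝ} (ht : a < t) (h : ∀ s, a ≤ s → g s = c) :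
    slopeL g t = 0 := by
  refine SlopeL.eq ((slopeL_const c t).congr ?_ (h t ht.le).symm)
  filter_upwards [Ioo_mem_nhdsLT ht] with s hs
  exact (h s hs.1.le).symm

end PiecewiseLinear

/-! ### Vertices are rank-determining on a metric graph -/

namespace MetricGraph

open PiecewiseLinear DivisorTheory Filter Topology

open Classical in
/-- The function on a metric graph given by a function on the closed edge `e` that vanishes at the
ends of `e`. -/
noncomputable def extendZero {α β : Type*} {G : Graph α β} {ℓ : E(G) → ℝ} (e : E(G)) (g : ℝ → ℝ) :
    MetricGraph G ℓ → ℝ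
  | vertex _ => 0
  | edgePoint e' t => if e' = e then g t else 0

lemma extendZero_edgePath {α β : Type*} {G : Graph α β} {ℓ : E(G) → ℝ} (hℓ : ∀ e, 0 < ℓ e)
    (e : E(G)) {g : ℝ → ℝ} (h0 : ∀ t ≤ 0, g t = 0) (h1 : ∀ t, ℓ e ≤ t → g t = 0) (t : ℝ) :
    extendZero (ℓ := ℓ) e g (edgePath e t) = g t := by
  rcases le_or_gt t 0 with ht | ht
  · rw [edgePath_of_nonpos e ht, extendZero, h0 t ht]
  rcases le_or_gt (ℓ e) t with ht' | ht'
  · rw [edgePath_of_le e (hℓ e) ht', extendZero, h1 t ht']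
  · rw [edgePath_of_mem e ⟨ht, ht'⟩, extendZero, if_pos rfl]

lemma extendZero_edgePath_of_ne {α β : Type*} {G : Graph α β} {ℓ : E(G) → ℝ}
    (hℓ : ∀ e, 0 < ℓ e) {e e' : E(G)} (he : e' ≠ e) (g : ℝ → ℝ) (t : ℝ) :
    extendZero (ℓ := ℓ) e g (edgePath e' t) = 0 := by
  rcases le_or_gt t 0 with ht | ht
  · rw [edgePath_of_nonpos e' ht, extendZero]
  rcases le_or_gt (ℓ e') t with ht' | ht'
  · rw [edgePath_of_le e' (hℓ e') ht', extendZero]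
  · rw [edgePath_of_mem e' ⟨ht, ht'⟩, extendZero, if_neg he]

/-- If an effective divisor on a metric graph has a chip on an edge on either side of a point of
that edge, then an equivalent effective divisor has a chip at this point. -/
lemma exists_chip_of_chips_on_edge {α β : Type*} {G : Graph α β} [Finite V(G)] [Fintype E(G)]
    (hloop : G.Loopless) {ℓ : E(G) → ℝ} (hℓ : ∀ e, 0 < ℓ e) {D : MetricGraph G ℓ →₀ ℤ}
    (hD : 0 ≤ D) (e : E(G)) {a p b : ℝ} (ha : 0 ≤ a) (hap : a ≤ p) (hpb : p ≤ b) (hb : b ≤ ℓ e)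
    (hDa : 1 ≤ D (edgePath e a)) (hDb : 1 ≤ D (edgePath e b)) :
    ∃ E, 0 ≤ E ∧ E - D ∈ principal G hℓ ∧ 1 ≤ E (edgePath e p) := by
  classical
  rcases hap.eq_or_lt with rfl | hap
  · exact ⟨D, hD, by simp, hDa⟩
  rcases hpb.eq_or_lt with rfl | hpb
  · exact ⟨D, hD, by simp, hDb⟩
  obtain ⟨g, hgPL, hga, hgb, hg, hgRa, hgLb, hgp⟩ := exists_tent hap hpb
  obtain ⟨f, hf⟩ : ∃ f : MetricGraph G ℓ → ℝ, f = extendZero e g := ⟨_, rfl⟩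
  have hfe : (fun t => f (edgePath e t)) = g := funext fun t => by
    rw [hf]
    exact extendZero_edgePath hℓ e (fun s hs => hga s (hs.trans ha))
      (fun s hs => hgb s (hb.trans hs)) t
  have hfe' : ∀ e' ≠ e, (fun t => f (edgePath e' t)) = fun _ => 0 := fun e' he' =>
    funext fun t => by rw [hf]; exact extendZero_edgePath_of_ne hℓ he' g t
  have hfrat : IsRational f := by
    rw [isRational_iff hℓ]
    intro e'
    by_cases he' : e' = e
    · subst he'
      rw [hfe]
      exact hgPL
    · rw [hfe' e' he']
      exact isPL_const 0
  obtain ⟨A, hA, hAf⟩ := exists_mem_principal hℓ hfrat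
  refine ⟨D + A, fun x => ?_, by simpa using hA, ?_⟩
  · have hDx : 0 ≤ D x := hD x
    rw [Finsupp.add_apply, hAf, Finsupp.coe_zero, Pi.zero_apply]
    cases x with
    | vertex v =>
      rw [ordInt, Finset.sum_eq_single e]
      · rw [hfe]
        have hst := src_ne_tgt G hloop e
        by_cases hs : G.src e = v
        · have ht : G.tgt e ≠ v := fun h => hst (hs.trans h.symm)
          rw [if_pos hs, if_neg ht]
          rcases ha.eq_or_lt with rfl | ha
          · rw [edgePath_of_nonpos e le_rfl, hs] at hDa
            omega
          · rw [slopeR_eq_zero_of_lt ha hga]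
            omega
        · rw [if_neg hs]
          split_ifs with ht
          · rcases hb.eq_or_lt with rfl | hb
            · rw [edgePath_of_le e (hℓ e) le_rfl, ht] at hDb
              omega
            · rw [slopeL_eq_zero_of_gt hb hgb]
              omega
          · omega
      · intro e' _ he'
        rw [hfe' e' he', (slopeR_const 0 _).eq, (slopeL_const 0 _).eq]
        simp
      · simp
    | edgePoint e' t =>
      rw [ordInt]
      by_cases he' : e' = e
      · subst he'
        rw [hfe]
        rcases eq_or_ne (t : ℝ) a with hta | hta
        · rw [← hta, edgePath_of_mem e' t.2] at hDa
          have h0 : 0 ≤ slopeL g t :=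
            ((slopeL_const 0 (t : ℝ)).congr (by
              filter_upwards [self_mem_nhdsWithin] with s hs
              exact (hga s ((mem_Iio.1 hs).le.trans hta.le)).symm) (hga t hta.le).symm).eq.ge
          have : -1 ≤ slopeR g t := hta ▸ hgRa
          have hDa : 1 ≤ D (edgePoint e' t) := hDa
          omega
        · rcases eq_or_ne (t : ℝ) b with htb | htb
          · rw [← htb, edgePath_of_mem e' t.2] at hDb
            have h0 : 0 ≤ slopeR g t :=
              ((slopeR_const 0 (t : ℝ)).congr (by
                filter_upwards [self_mem_nhdsWithin] with s hs
                exact (hgb s (htb.ge.trans (mem_Ioi.1 hs).le)).symm) (hgb t htb.ge).symm).eq.ge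
            have : -1 ≤ slopeL g t := htb ▸ hgLb
            have hDb : 1 ≤ D (edgePoint e' t) := hDb
            omega
          · have := hg t hta htb
            omega
      · rw [hfe' e' he', (slopeR_const 0 _).eq, (slopeL_const 0 _).eq]
        simpa using hDx
  · have hDx : 0 ≤ D (edgePath e p) := hD _
    rw [Finsupp.add_apply, hAf]
    have hp : p ∈ Ioo 0 (ℓ e) := ⟨by linarith, by linarith⟩
    rw [edgePath_of_mem e hp] at hDx ⊢
    rw [ordInt, hfe]
    dsimp only
    omega

/-- The vertices determine the ranks of divisors on a metric graph. -/
lemma vertex_determining {α β : Type*} (G : Graph α β) [Finite V(G)] [Fintype E(G)]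
    (hloop : G.Loopless) {ℓ : E(G) → ℝ} (hℓ : ∀ e, 0 < ℓ e) (D : MetricGraph G ℓ →₀ ℤ)
    (h : ∀ v, ∃ E, 0 ≤ E ∧ E - D ∈ principal G hℓ ∧ 1 ≤ E (vertex v)) (x : MetricGraph G ℓ) :
    ∃ E, 0 ≤ E ∧ E - D ∈ principal G hℓ ∧ 1 ≤ E x := by
  cases x with
  | vertex v => exact h v
  | edgePoint e p =>
  obtain ⟨p, hp⟩ := p
  rw [← edgePath_of_mem e hp]
  obtain ⟨D₁, hD₁, hDD₁, hu⟩ := h (G.src e)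
  obtain ⟨D₂, hD₂, hDD₂, hv⟩ := h (G.tgt e)
  obtain ⟨f, hf, hfD⟩ : D₂ - D₁ ∈ principal G hℓ := by
    have := sub_mem hDD₂ hDD₁
    simpa using this
  set c := f (edgePath e p) with hc
  -- The same truncation as on subdivisions, at the value of `f` at the target point.
  obtain ⟨h, hh⟩ : ∃ h : MetricGraph G ℓ → ℝ, h = fun x => max (f x) c := ⟨_, rfl⟩
  have hrat : IsRational h := hh ▸ hf.max hℓ (isRational_const hℓ c)
  have hfh : f ≤ h := fun x => by rw [hh]; exact le_max_left _ _
  have hch : (fun _ => c) ≤ h := fun x => by rw [hh]; exact le_max_right _ _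
  obtain ⟨A, hA, hAh⟩ := exists_mem_principal hℓ hrat
  have hle : ∀ x, f x ≤ c → D₁ x ≤ (D₁ + A) x := by
    intro x hx
    have := ordInt_mono hℓ (isRational_const hℓ c) hrat hch (p := x)
      (by rw [hh]; exact (max_eq_right hx).symm)
    rw [ordInt_const] at this
    rw [Finsupp.add_apply, hAh]
    omega
  have hge : ∀ x, c ≤ f x → D₂ x ≤ (D₁ + A) x := by
    intro x hx
    have := ordInt_mono hℓ hf hrat hfh (p := x) (by rw [hh]; exact (max_eq_left hx).symm)
    have h2 := hfD x
    rw [Finsupp.sub_apply] at h2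
    rw [Finsupp.add_apply, hAh]
    omega
  have hnonneg : 0 ≤ D₁ + A := fun x => by
    rcases le_total (f x) c with hx | hx
    · exact (hD₁ x).trans (hle x hx)
    · exact (hD₂ x).trans (hge x hx)
  have hfPL := (isRational_iff hℓ).1 hf e
  have hhPL := (isRational_iff hℓ).1 hrat e
  -- If there is no chip at a point of level `c`, then `h` and `f` both have order `0` there. The
  -- slopes of `h` are nonnegative and bound those of `f` from above, so all of them vanish and `f`
  -- is constant near the point along `e`.
  have hstep : ∀ t ∈ Ioo 0 (ℓ e), f (edgePath e t) = c → (D₁ + A) (edgePath e t) < 1 →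
      SlopeR (fun t => f (edgePath e t)) t 0 ∧ SlopeL (fun t => f (edgePath e t)) t 0 := by
    intro t ht htc hchip
    have hht : h (edgePath e t) = c := by rw [hh]; exact max_eq_right htc.le
    have hR := hfPL.slopeR t
    have hL := hfPL.slopeL t
    have h1 := (slopeR_const c t).mono (hhPL.slopeR t) (fun s => hch _) hht.symm
    have h2 := (slopeL_const c t).mono (hhPL.slopeL t) (fun s => hch _) hht.symm
    have h3 := hR.mono (hhPL.slopeR t) (fun s => hfh _) (htc.trans hht.symm)
    have h4 := hL.mono (hhPL.slopeL t) (fun s => hfh _) (htc.trans hht.symm)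
    have h5 : 0 ≤ D₁ (edgePath e t) := hD₁ _
    have h6 : 0 ≤ D₂ (edgePath e t) := hD₂ _
    have h7 := hfD (edgePath e t)
    rw [Finsupp.add_apply, hAh] at hchip
    rw [Finsupp.sub_apply] at h7
    rw [edgePath_of_mem e ht] at h5 h6 h7 hchip
    rw [ordInt] at h7 hchip
    dsimp only at h7 hchip
    have h8 : slopeR (fun s => f (edgePath e s)) t = 0 := by omega
    have h9 : slopeL (fun s => f (edgePath e s)) t = 0 := by omega
    rw [h8] at hR
    rw [h9] at hL
    exact ⟨hR, hL⟩
  have hclosed : IsClosed {t | f (edgePath e t) = c} :=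
    isClosed_eq hfPL.continuous continuous_const
  have hright : ∃ b, p ≤ b ∧ b ≤ ℓ e ∧ 1 ≤ (D₁ + A) (edgePath e b) := by
    by_contra! hno
    have : ℓ e ∈ {t | f (edgePath e t) = c} := by
      -- Continuous induction replaces the step-by-step propagation: the level set is closed, and
      -- without chips it can always be extended a little to the right.
      refine (hclosed.inter isClosed_Icc).mem_of_ge_of_forall_exists_gt (a := p) rfl hp.2.le ?_
      rintro t ⟨htc : f (edgePath e t) = c, ht⟩
      have hR := (hstep t ⟨hp.1.trans_le ht.1, ht.2⟩ htc (hno t ht.1 ht.2.le)).1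
      obtain ⟨s, hs, hs'⟩ := (Eventually.and hR (Ioo_mem_nhdsGT ht.2)).exists
      exact ⟨s, by simpa [htc] using hs, hs'.1, hs'.2.le⟩
    have h1 := hno (ℓ e) hp.2.le le_rfl
    have h2 := hge (edgePath e (ℓ e)) (Eq.ge this)
    rw [edgePath_of_le e (hℓ e) le_rfl] at h1 h2
    omega
  have hleft : ∃ a, 0 ≤ a ∧ a ≤ p ∧ 1 ≤ (D₁ + A) (edgePath e a) := by
    by_contra! hno
    have : (0 : ℝ) ∈ {t | f (edgePath e t) = c} := by
      refine (hclosed.inter isClosed_Icc).mem_of_ge_of_forall_exists_lt (b := p) rfl hp.1.le ?_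
      rintro t ⟨htc : f (edgePath e t) = c, ht⟩
      have hL := (hstep t ⟨ht.1, ht.2.trans_lt hp.2⟩ htc (hno t ht.1.le ht.2)).2
      obtain ⟨s, hs, hs'⟩ := (Eventually.and hL (Ioo_mem_nhdsLT ht.1)).exists
      exact ⟨s, by simpa [htc] using hs, hs'.1.le, hs'.2⟩
    have h1 := hno 0 le_rfl hp.1.le
    have h2 := hle (edgePath e 0) (Eq.le this)
    rw [edgePath_of_nonpos e le_rfl] at h1 h2
    omega
  obtain ⟨b, hpb, hb, hDb⟩ := hright
  obtain ⟨a, ha, hap, hDa⟩ := hleft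
  obtain ⟨E, hE, hDE, hEp⟩ :=
    exists_chip_of_chips_on_edge hloop hℓ hnonneg e ha hap hpb hb hDa hDb
  refine ⟨E, hE, ?_, hEp⟩
  have := add_mem (add_mem hDE hA) hDD₁
  convert this using 1
  abel

lemma rankGE_of_vertices {α β : Type*} (G : Graph α β) [Finite V(G)] [Fintype E(G)]
    (hloop : G.Loopless) {ℓ : E(G) → ℝ} (hℓ : ∀ e, 0 < ℓ e) {k : ℕ} {D : MetricGraph G ℓ →₀ ℤ}
    (h : ∀ l : List V(G), l.length = k →
      (linearSystem (DivEquiv G ℓ) (D - listDivisor (l.map vertex))).Nonempty) :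
    RankGE (DivEquiv G ℓ) k D := by
  refine rankGE_of_determining vertex (fun D hD x => ?_) h
  have hR := divEquiv_iff G hℓ
  simp only [linearSystem_sub_single_nonempty hR] at hD ⊢
  exact vertex_determining G hloop hℓ D hD x

end MetricGraph

/-! ### From the graph to its metric graph -/

namespace MetricGraph

open PiecewiseLinear DivisorTheory Filter Topology

lemma vertex_injective {α β : Type*} {G : Graph α β} {ℓ : E(G) → ℝ} :
    Function.Injective (vertex : V(G) → MetricGraph G ℓ) := fun _ _ h => by
  injection h

/-- The clamp to `[0, 1]` matches the constant continuation of `edgePath` beyond the ends of a unit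
edge. -/
lemma slopes_clamp (k : ℤ) (c : ℝ) {g : ℝ → ℝ}
    (hg : g = fun t => c + k * max 0 (min 1 t)) :
    IsPL g ∧ slopeR g 0 = k ∧ slopeL g 1 = -k ∧
      ∀ t ∈ Ioo (0 : ℝ) 1, slopeR g t + slopeL g t = 0 := by
  have hlin : ∀ t ∈ Icc (0 : ℝ) 1, g t = k * t + c := fun t ht => by
    rw [hg]
    dsimp only
    rw [min_eq_right ht.2, max_eq_right ht.1, add_comm]
  refine ⟨?_, (slopeR_of_linear one_pos hlin).eq, (slopeL_of_linear one_pos hlin).eq,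
    fun t ht => ?_⟩
  · rw [hg]
    exact (isPL_const c).add (((isPL_const 0).max ((isPL_const 1).min isPL_id)).const_mul k)
  · rw [(slopeR_of_linear ht.2 fun s hs => hlin s ⟨ht.1.le.trans hs.1, hs.2⟩).eq,
      (slopeL_of_linear ht.1 fun s hs => hlin s ⟨hs.1, hs.2.trans ht.2.le⟩).eq]
    ring

/-- The linear extension of a function on the vertices to the metric graph with unit lengths. -/
noncomputable def linearExtension {α β : Type*} {G : Graph α β} (σ : V(G) → ℤ) :
    MetricGraph G G.unitLength → ℝ
  | vertex v => σ v
  | edgePoint e t => σ (G.src e) + (σ (G.tgt e) - σ (G.src e)) * t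

lemma linearExtension_edgePath {α β : Type*} {G : Graph α β} (σ : V(G) → ℤ) (e : E(G)) :
    (fun t => linearExtension σ (edgePath e t)) = fun t : ℝ =>
      (σ (G.src e) : ℝ) + ((σ (G.tgt e) - σ (G.src e) : ℤ) : ℝ) * max 0 (min 1 t) := by
  funext t
  have h1 : G.unitLength e = 1 := rfl
  rcases le_or_gt t 0 with ht | ht
  · rw [edgePath_of_nonpos e ht, max_eq_left ((min_le_right _ _).trans ht), linearExtension]
    simp
  rcases le_or_gt 1 t with ht' | ht'
  · rw [edgePath_of_le e (by rw [h1]; exact one_pos) (h1 ▸ ht'), min_eq_left ht',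
      max_eq_right zero_le_one, linearExtension]
    push_cast
    ring
  · rw [edgePath_of_mem e ⟨ht, h1 ▸ ht'⟩, min_eq_right ht'.le, max_eq_right ht.le,
      linearExtension]
    push_cast
    ring

/-- On an edge of length `1` linear interpolation has integer slope, the difference of the end
values. So its order vanishes inside edges and is the divisor of `σ` at the vertices. -/
lemma mapDomain_vertex_mem_principal {α β : Type*} (G : Graph α β) [Fintype E(G)]
    (hℓ : ∀ e, 0 < G.unitLength e) {A : V(G) →₀ ℤ} (hA : A ∈ Graph.principal G.src G.tgt) :
    Finsupp.mapDomain vertex A ∈ principal G hℓ := by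
  classical
  obtain ⟨σ, hσ⟩ := hA
  have hs := fun e => slopes_clamp _ _ (linearExtension_edgePath σ e)
  refine ⟨linearExtension σ, (isRational_iff hℓ).2 fun e => (hs e).1, fun p => ?_⟩
  cases p with
  | vertex v =>
    rw [Finsupp.mapDomain_apply vertex_injective, hσ, ordInt, edgeDiv]
    refine Finset.sum_congr rfl fun e _ => ?_
    rw [(hs e).2.1, show G.unitLength e = 1 from rfl, (hs e).2.2.1]
    congr 1
    · split_ifs with h
      · rw [h]
      · rfl
    · split_ifs with h
      · rw [h]
        ring
      · rfl
  | edgePoint e t =>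
    rw [Finsupp.mapDomain_of_notMem_range _ _ (by rintro ⟨v, hv⟩; cases hv), ordInt,
      (hs e).2.2.2 t t.2]

/-- The rank of a divisor on a graph does not drop when it is considered on the metric graph. -/
lemma rankGE_mapDomain_vertex {α β : Type*} (G : Graph α β) [Finite V(G)] [Fintype E(G)]
    (hloop : G.Loopless) {k : ℕ} {D : V(G) →₀ ℤ} (h : RankGE G.DivEquiv k D) :
    RankGE (DivEquiv G G.unitLength) k (Finsupp.mapDomain vertex D) := by
  have hℓ : ∀ e, 0 < G.unitLength e := fun _ => one_pos
  refine rankGE_of_vertices G hloop hℓ fun l hl => ?_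
  obtain ⟨E, hE, hDE⟩ := h (listDivisor l) (listDivisor_nonneg l)
    (by rw [degree_listDivisor, hl])
  refine ⟨Finsupp.mapDomain vertex E, mapDomain_nonneg _ hE, ?_⟩
  rw [Graph.divEquiv_iff G hloop] at hDE
  rw [divEquiv_iff G hℓ, ← mapDomain_listDivisor]
  have := mapDomain_vertex_mem_principal G hℓ hDE
  rw [← Finsupp.mapDomain.addMonoidHom_apply, map_sub, map_sub] at this
  exact this

end MetricGraph

/-! ### Replacing real positions and values by integers -/

/-- There is an additive function on the real numbers that is integral on a given finite set, and
positive on the positive elements of this set. -/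
lemma exists_addMonoidHom_integral_pos (T : Finset ℝ) :
    ∃ (φ : ℝ →+ ℝ) (z : ℝ → ℤ), ∀ x ∈ T, φ x = z x ∧ (0 < x → 0 < z x) := by
  obtain ⟨ψ, hψ⟩ : ∃ ψ : ℝ →ₗ[ℚ] ℚ, ∀ x ∈ T, 0 < x → 0 < ψ x := by
    set W := Submodule.span ℚ (T : Set ℝ) with hW
    have : FiniteDimensional ℚ W := FiniteDimensional.span_finset ℚ T
    set b := Module.finBasis ℚ W with hb
    have hmem : ∀ x ∈ T, x ∈ W := fun x hx => Submodule.subset_span hx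
    -- A linear functional on `W` is given by its values on the basis `b`. Positivity on the
    -- positive elements of `T` is an open condition on these values, and the inclusion of `W` into
    -- `ℝ`, given by `b i` itself, satisfies it. Hence rational values satisfying it exist.
    have hopen : IsOpen {c : Fin (Module.finrank ℚ W) → ℝ |
        ∀ x (hx : x ∈ T), 0 < x → 0 < ∑ i, (b.repr ⟨x, hmem x hx⟩ i : ℝ) * c i} := by
      have : {c : Fin (Module.finrank ℚ W) → ℝ |
          ∀ x (hx : x ∈ T), 0 < x → 0 < ∑ i, (b.repr ⟨x, hmem x hx⟩ i : ℝ) * c i} =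
          ⋂ x : T, {c | 0 < (x : ℝ) → 0 < ∑ i, (b.repr ⟨x, hmem x x.2⟩ i : ℝ) * c i} := by
        ext c
        simp
      rw [this]
      refine isOpen_iInter_of_finite fun x => ?_
      by_cases hx : 0 < (x : ℝ)
      · simp only [hx, true_imp_iff]
        exact isOpen_lt continuous_const (by fun_prop)
      · simp [hx]
    have hne : {c : Fin (Module.finrank ℚ W) → ℝ |
        ∀ x (hx : x ∈ T), 0 < x → 0 < ∑ i, (b.repr ⟨x, hmem x hx⟩ i : ℝ) * c i}.Nonempty := by
      refine ⟨fun i => (b i : ℝ), fun x hx h0 => ?_⟩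
      have h1 := congrArg (Subtype.val : W → ℝ) (b.sum_repr ⟨x, hmem x hx⟩)
      rw [AddSubmonoidClass.coe_finsetSum] at h1
      simp only [Submodule.coe_smul, Rat.smul_def] at h1
      rw [h1]
      exact h0
    have hdense : DenseRange (fun (q : Fin (Module.finrank ℚ W) → ℚ) i => (q i : ℝ)) :=
      DenseRange.piMap fun _ => Rat.denseRange_cast
    obtain ⟨q, hq⟩ := hdense.exists_mem_open hopen hne
    obtain ⟨ψ, hψ⟩ := LinearMap.exists_extend (p := W) (b.constr ℚ q)
    refine ⟨ψ, fun x hx h0 => ?_⟩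
    have h1 : ψ x = ∑ i, b.repr ⟨x, hmem x hx⟩ i * q i := by
      have := LinearMap.congr_fun hψ ⟨x, hmem x hx⟩
      rw [Module.Basis.constr_apply_fintype] at this
      simpa using this
    have h2 : (0 : ℝ) < ∑ i, (b.repr ⟨x, hmem x hx⟩ i : ℝ) * (q i : ℝ) := hq x hx h0
    rw [h1]
    exact_mod_cast h2
  -- A common denominator of the values on `T`.
  obtain ⟨N, hN⟩ : ∃ N : ℕ, N = ∏ x ∈ T, (ψ x).den := ⟨_, rfl⟩
  have hN0 : 0 < N := hN ▸ Finset.prod_pos fun x _ => (ψ x).den_pos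
  have hint : ∀ x ∈ T, ((⌊(N : ℚ) * ψ x⌋ : ℤ) : ℚ) = N * ψ x := by
    intro x hx
    obtain ⟨M, hM⟩ : (ψ x).den ∣ N := hN ▸ Finset.dvd_prod_of_mem (fun x => (ψ x).den) hx
    have : (N : ℚ) * ψ x = ((M * (ψ x).num : ℤ) : ℚ) := by
      rw [hM]
      push_cast
      rw [mul_comm ((ψ x).den : ℚ), mul_assoc, mul_comm ((ψ x).den : ℚ), Rat.mul_den_eq_num]
    rw [this, Int.floor_intCast]
  refine ⟨((Rat.castHom ℝ : ℚ →+* ℝ) : ℚ →+ ℝ).comp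
    ((AddMonoidHom.mulLeft (N : ℚ)).comp (ψ : ℝ →+ ℚ)), fun x => ⌊(N : ℚ) * ψ x⌋,
    fun x hx => ⟨?_, fun h0 => ?_⟩⟩
  · have := congrArg (Rat.cast : ℚ → ℝ) (hint x hx)
    simpa using this.symm
  · have h1 : (0 : ℚ) < N * ψ x := mul_pos (by exact_mod_cast hN0) (hψ x hx h0)
    rw [← hint x hx] at h1
    exact_mod_cast h1

namespace PiecewiseLinear

/-- A piecewise linear function on `[0, 1]` with break points in `P` is turned into a function on
the integers by a map that is the restriction of an additive function. -/
lemma exists_integral_interpolation {P : Finset ℝ} (hP : ∀ t ∈ P, t ∈ Icc (0 : ℝ) 1)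
    (h0 : 0 ∈ P) (h1 : 1 ∈ P) {φ : ℝ →+ ℝ} {z : ℝ → ℤ} (hz : ∀ t ∈ P, φ t = z t)
    (hmono : ∀ s ∈ P, ∀ t ∈ P, s < t → z s < z t) {g : ℝ → ℝ} (hgz : ∀ t ∈ P, φ (g t) = z (g t))
    (hg : LinearOffOn g P 0 1) :
    ∃ s : ℤ → ℤ, (∀ t ∈ P, s (z t) = z (g t)) ∧
      (∀ t ∈ P, t < 1 → s (z t + 1) - s (z t) = slopeR g t) ∧
      (∀ t ∈ P, 0 < t → s (z t - 1) - s (z t) = slopeL g t) ∧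
      ∀ j, 0 < j → j < z 1 → (∀ t ∈ P, z t ≠ j) → s (j + 1) + s (j - 1) - 2 * s j = 0 := by
  have hz0 : z 0 = 0 := by
    have := hz 0 h0
    rw [map_zero] at this
    exact_mod_cast this.symm
  -- `A j` is the last point of `P` whose image is at most `j`, the left end of the piece containing
  -- `j`; for negative `j` the value is irrelevant.
  have hexA : ∀ j : ℤ, ∃ a : ℝ, 0 ≤ j → a ∈ P ∧ z a ≤ j ∧ ∀ t ∈ P, z t ≤ j → t ≤ a := by
    intro j
    by_cases hj : 0 ≤ j
    · obtain ⟨a, ha, hmax⟩ := (P.filter fun t => z t ≤ j).exists_max_image id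
        ⟨0, Finset.mem_filter.2 ⟨h0, by rwa [hz0]⟩⟩
      rw [Finset.mem_filter] at ha
      exact ⟨a, fun _ => ⟨ha.1, ha.2, fun t ht htj => hmax t (Finset.mem_filter.2 ⟨ht, htj⟩)⟩⟩
    · exact ⟨0, fun h => absurd h hj⟩
  choose A hA using hexA
  have hle : ∀ s ∈ P, ∀ t ∈ P, z s ≤ z t → s ≤ t := fun s hs t ht h => by
    by_contra! hlt
    have := hmono t ht s hs hlt
    omega
  have hznonneg : ∀ t ∈ P, 0 ≤ z t := fun t ht => by
    rcases (hP t ht).1.eq_or_lt with rfl | h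
    · exact hz0.ge
    · have := hmono 0 h0 t ht h
      omega
  have hAz : ∀ t ∈ P, A (z t) = t := fun t ht => by
    obtain ⟨hA1, hA2, hA3⟩ := hA (z t) (hznonneg t ht)
    exact le_antisymm (hle _ hA1 _ ht hA2) (hA3 t ht le_rfl)
  -- Start from the transported value at the left end and continue with the slope that `g` has to
  -- its right.
  obtain ⟨s, hs⟩ : ∃ s : ℤ → ℤ, ∀ j, s j = z (g (A j)) + slopeR g (A j) * (j - z (A j)) :=
    ⟨_, fun _ => rfl⟩
  have hsz : ∀ t ∈ P, s (z t) = z (g t) := fun t ht => by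
    rw [hs, hAz t ht]
    ring
  have key : ∀ a ∈ P, ∀ b ∈ P, a < b → (∀ t ∈ P, t ∉ Ioo a b) →
      slopeL g b = -slopeR g a ∧
      ∀ j, z a ≤ j → j ≤ z b → s j = z (g a) + slopeR g a * (j - z a) := by
    intro a ha b hb hab hno
    obtain ⟨m, c, hm⟩ := hg a b (hP a ha).1 hab (hP b hb).2 hno
    have hR := (slopeR_of_linear hab hm).eq
    refine ⟨by rw [hR, (slopeL_of_linear hab hm).eq], fun j haj hjb => ?_⟩
    rcases hjb.eq_or_lt with rfl | hjb
    · rw [hsz b hb, hR]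
      -- The pieces fit together because `m` is an integer: the additive `φ` turns this identity
      -- into the same one with slope `m` between the images.
      have h2 : g b = g a + m • (b - a) := by
        rw [hm b ⟨hab.le, le_rfl⟩, hm a ⟨le_rfl, hab.le⟩, zsmul_eq_mul]
        ring
      have h3 := congrArg φ h2
      rw [map_add, map_zsmul, map_sub, hgz a ha, hgz b hb, hz a ha, hz b hb, zsmul_eq_mul] at h3
      exact_mod_cast h3
    · have : A j = a := by
        obtain ⟨hA1, hA2, hA3⟩ := hA j ((hznonneg a ha).trans haj)
        refine le_antisymm ?_ (hA3 a ha haj)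
        by_contra! hlt
        have h2 : b ≤ A j := by
          by_contra! h2
          exact hno _ hA1 ⟨hlt, h2⟩
        rcases h2.eq_or_lt with h2 | h2
        · rw [← h2] at hA2
          omega
        · have := hmono b hb _ hA1 h2
          omega
      rw [hs, this]
  have hnext : ∀ t ∈ P, t < 1 → ∃ b ∈ P, t < b ∧ ∀ u ∈ P, u ∉ Ioo t b := by
    intro t ht ht1
    obtain ⟨b, hb, hmin⟩ := (P.filter fun u => t < u).exists_min_image id
      ⟨1, Finset.mem_filter.2 ⟨h1, ht1⟩⟩
    rw [Finset.mem_filter] at hb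
    exact ⟨b, hb.1, hb.2, fun u hu hu' =>
      absurd (hmin u (Finset.mem_filter.2 ⟨hu, hu'.1⟩)) (not_le.2 hu'.2)⟩
  have hprev : ∀ t ∈ P, 0 < t → ∃ a ∈ P, a < t ∧ ∀ u ∈ P, u ∉ Ioo a t := by
    intro t ht ht0
    obtain ⟨a, ha, hmax⟩ := (P.filter fun u => u < t).exists_max_image id
      ⟨0, Finset.mem_filter.2 ⟨h0, ht0⟩⟩
    rw [Finset.mem_filter] at ha
    exact ⟨a, ha.1, ha.2, fun u hu hu' =>
      absurd (hmax u (Finset.mem_filter.2 ⟨hu, hu'.2⟩)) (not_le.2 hu'.1)⟩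
  refine ⟨s, hsz, fun t ht ht1 => ?_, fun t ht ht0 => ?_, fun j hj hj1 hjP => ?_⟩
  · obtain ⟨b, hb, htb, hno⟩ := hnext t ht ht1
    have hzz := hmono t ht b hb htb
    rw [(key t ht b hb htb hno).2 _ (by omega) (by omega), hsz t ht]
    ring
  · obtain ⟨a, ha, hat, hno⟩ := hprev t ht ht0
    have hzz := hmono a ha t ht hat
    rw [(key a ha t ht hat hno).2 _ (by omega) (by omega),
      (key a ha t ht hat hno).2 _ (by omega) (by omega), (key a ha t ht hat hno).1]
    ring
  · obtain ⟨hA1, hA2, hA3⟩ := hA j hj.le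
    have hAj : z (A j) < j := lt_of_le_of_ne hA2 (hjP _ hA1)
    have hA1' : A j < 1 := by
      refine lt_of_le_of_ne (hP _ hA1).2 fun h => ?_
      rw [h] at hAj
      omega
    obtain ⟨b, hb, htb, hno⟩ := hnext _ hA1 hA1'
    have hjb : j < z b := by
      by_contra! h
      exact absurd (hA3 b hb h) (not_le.2 htb)
    have hk := (key _ hA1 b hb htb hno).2
    rw [hk _ (by omega) (by omega), hk _ (by omega) (by omega), hk j (by omega) (by omega)]
    ring

end PiecewiseLinear

/-! ### From the metric graph to a subdivision -/

namespace MetricGraph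

open PiecewiseLinear DivisorTheory

/-- The map from the metric graph with unit lengths to a subdivision that moves the point of an
edge at position `t` to the vertex number `z t` on the path of the edge. -/
noncomputable def toSubdivision {α β : Type*} (G : Graph α β) (n : E(G) → ℕ) (z : ℝ → ℤ) :
    MetricGraph G G.unitLength → V(G.subdivide n)
  | vertex v => G.oldVertex n v
  | edgePoint e t => G.pathPoint n e (z t).toNat

lemma injOn_toSubdivision {α β : Type*} (G : Graph α β) {n : E(G) → ℕ} {z : ℝ → ℤ} {P : Set ℝ}
    (hz : ∀ t ∈ P ∩ Ioo 0 1, ∀ e, 0 < z t ∧ z t < n e) (hinj : InjOn z P) :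
    InjOn (toSubdivision G n z) {p | ∀ e t, p = edgePoint e t → (t : ℝ) ∈ P} := by
  intro p hp q hq h
  cases p with
  | vertex v =>
    cases q with
    | vertex w => rw [G.oldVertex_injective n h]
    | edgePoint e t =>
      have := hz t ⟨hq e t rfl, t.2⟩ e
      exact absurd h.symm (pathPoint_ne_oldVertex G n e (by omega) (by omega) v)
  | edgePoint e t =>
    have ht := hz t ⟨hp e t rfl, t.2⟩ e
    cases q with
    | vertex w => exact absurd h (pathPoint_ne_oldVertex G n e (by omega) (by omega) w)
    | edgePoint e' t' =>
      have ht' := hz t' ⟨hq e' t' rfl, t'.2⟩ e'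
      obtain ⟨rfl, h⟩ := (pathPoint_eq_iff G n (i := (z t').toNat) (by omega) (by omega)).1 h
      rw [Subtype.ext (hinj (hp _ t rfl) (hq _ t' rfl) (by omega))]

/-- Principal divisors on the metric graph are turned into principal divisors on a subdivision. -/
lemma mapDomain_toSubdivision_mem {α β : Type*} (G : Graph α β) [Fintype E(G)]
    (hℓ : ∀ e, 0 < G.unitLength e) {P : Finset ℝ} (hP : ∀ t ∈ P, t ∈ Icc (0 : ℝ) 1)
    (h0 : 0 ∈ P) (h1 : 1 ∈ P) {φ : ℝ →+ ℝ} {z : ℝ → ℤ} (hz : ∀ t ∈ P, φ t = z t)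
    (hmono : ∀ s ∈ P, ∀ t ∈ P, s < t → z s < z t)
    {f : MetricGraph G G.unitLength → ℝ}
    (hfz : ∀ e, ∀ t ∈ P, φ (f (edgePath e t)) = z (f (edgePath e t)))
    (hflin : ∀ e, LinearOffOn (fun t => f (edgePath e t)) P 0 1)
    {n : ℕ} (hn : z 1 = n) (hn0 : 1 ≤ n)
    {A : MetricGraph G G.unitLength →₀ ℤ} (hA : ∀ p, A p = ordInt f p) :
    Finsupp.mapDomain (toSubdivision G (fun _ => n) z) A ∈ G.subdivPrincipal fun _ => n := by
  classical
  choose s hsz hsR hsL hsno using fun e =>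
    exists_integral_interpolation hP h0 h1 hz hmono (hfz e) (hflin e)
  have hz0 : z 0 = 0 := by
    have := hz 0 h0
    rw [map_zero] at this
    exact_mod_cast this.symm
  have hs0 : ∀ e, s e 0 = z (f (vertex (G.src e))) := fun e => by
    have := hsz e 0 h0
    rwa [hz0, edgePath_of_nonpos e le_rfl] at this
  have hs1 : ∀ e, s e n = z (f (vertex (G.tgt e))) := fun e => by
    have := hsz e 1 h1
    rwa [hn, edgePath_of_le e (hℓ e) (t := 1) (le_refl (1 : ℝ))] at this
  -- The interpolations on the edges glue: by `hs0` and `hs1` their end values depend only on `f` at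
  -- the vertices.
  obtain ⟨σ, hσ⟩ : ∃ σ : V(G.subdivide fun _ => n) → ℤ, ∀ x, σ x =
      match (x : α ⊕ (E(G) × ℕ)) with
      | Sum.inl v => if h : v ∈ V(G) then z (f (vertex ⟨v, h⟩)) else 0
      | Sum.inr y => s y.1 y.2 := ⟨_, fun _ => rfl⟩
  have hσo : ∀ v, σ (G.oldVertex _ v) = z (f (vertex v)) := fun v => by
    rw [hσ]
    exact dif_pos v.2
  have hσe : ∀ e, ∀ j ≤ n, σ (G.pathPoint _ e j) = s e j := by
    intro e j hj
    rcases Nat.eq_zero_or_pos j with rfl | hj0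
    · rw [pathPoint_zero, hσo, ← hs0]
      rfl
    rcases hj.eq_or_lt with rfl | hj
    · rw [pathPoint_of_le G _ e hj0 le_rfl, hσo, hs1]
    · rw [hσ, pathPoint_val G _ e hj0 hj]
  have hzpos : ∀ t ∈ (P : Set ℝ) ∩ Ioo 0 1, 0 < z t ∧ z t < n := fun t ht => by
    have h2 := hmono 0 h0 t ht.1 ht.2.1
    have h3 := hmono t ht.1 1 h1 ht.2.2
    omega
  have hinj : InjOn z P := fun t ht u hu h => by
    rcases lt_trichotomy t u with h' | h' | h'
    · have := hmono t ht u hu h'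
      omega
    · exact h'
    · have := hmono u hu t ht h'
      omega
  -- Although `toSubdivision` need not be injective, `A` lives on vertices and break points, where
  -- it is injective, so no coefficients of `A` are merged.
  have hsupp : (A.support : Set (MetricGraph G G.unitLength)) ⊆ {p | ∀ e t, p = edgePoint e t → (t : ℝ) ∈ (P : Set ℝ)} := by
    rintro p hp e t rfl
    by_contra ht
    obtain ⟨m, hR, hL⟩ := (hflin e).exists_slopes_opposite t.2.1 t.2.2 ht
    rw [Finset.mem_coe, Finsupp.mem_support_iff, hA, ordInt, hR.eq, hL.eq] at hp
    exact hp (add_neg_cancel m)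
  have hmap := fun p (hp : p ∈ {p | ∀ e t, p = edgePoint e t → (t : ℝ) ∈ (P : Set ℝ)}) =>
    Finsupp.mapDomain_apply' _ A hsupp
      (injOn_toSubdivision G (n := fun _ => n) (fun t ht _ => hzpos t ht) hinj) hp
  refine ⟨σ, fun x => ?_⟩
  change _ = G.subdivDiv (fun _ => n) σ x
  rcases exists_eq_of_vertex_subdivide G _ x with ⟨v, rfl⟩ | ⟨e, j, hj0, hj, rfl⟩
  · rw [subdivDiv_oldVertex G _ fun _ => hn0]
    refine (hmap (vertex v) (by rintro e t ⟨⟩)).trans ?_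
    rw [hA, ordInt]
    refine Finset.sum_congr rfl fun e _ => ?_
    congr 1
    · split_ifs with hv
      · rw [hσe e 1 hn0, hσo, ← hv, ← hs0, ← hsR e 0 h0 one_pos, hz0]
        rfl
      · rfl
    · split_ifs with hv
      · rw [hσe e (n - 1) (Nat.sub_le _ _), hσo, ← hv, ← hs1,
          show G.unitLength e = 1 from rfl, ← hsL e 1 h1 one_pos, hn]
        push_cast [hn0]
        rfl
      · rfl
  · rw [subdivDiv_pathPoint G _ σ e hj0 hj, hσe e (j + 1) hj, hσe e (j - 1) (by omega),
      hσe e j hj.le]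
    push_cast [show 1 ≤ j from hj0]
    -- A path vertex either is the image of a position in `P`, with the slopes of `f` there, or lies
    -- inside a linear piece, where the second difference is `0` and no point of the support of `A`
    -- arrives.
    by_cases ht : ∃ t ∈ P, z t = j
    · obtain ⟨t, ht, htj⟩ := ht
      have ht0 : 0 < t := (hP t ht).1.lt_of_ne (by rintro rfl; omega)
      have ht1 : t < 1 := (hP t ht).2.lt_of_ne (by rintro rfl; omega)
      have h2 := hmap (edgePoint e ⟨t, ht0, ht1⟩) (by rintro e' t' ⟨⟩; exact ht)
      rw [toSubdivision, hA, ordInt] at h2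
      dsimp only at h2
      rw [← hsR e t ht ht1, ← hsL e t ht ht0, htj] at h2
      rw [Int.toNat_natCast] at h2
      rw [h2]
      ring
    · push Not at ht
      rw [hsno e j (by omega) (by omega) ht]
      by_contra hne
      have := Finsupp.mapDomain_support (Finsupp.mem_support_iff.2 hne)
      rw [Finset.mem_image] at this
      obtain ⟨p, hp, hpj⟩ := this
      cases p with
      | vertex v => exact pathPoint_ne_oldVertex G _ e hj0 hj v hpj.symm
      | edgePoint e' t =>
        have htP := hsupp hp e' t rfl
        have h2 := ((pathPoint_eq_iff G _ hj0 hj).1 hpj).2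
        have h3 := hzpos t ⟨htP, t.2⟩
        exact ht t htP (by omega)

/-- One `φ` is chosen for all the witnesses together, so that a single subdivision and a single `D'`
pass all tests. Pushing forward keeps degree and effectivity without any injectivity; only
differences of equivalent divisors need the finer analysis. -/
lemma exists_subdivision {α β : Type*} (G : Graph α β) [Finite V(G)] [Fintype E(G)]
    (hloop : G.Loopless) {ι : Type*} [Finite ι] (F : ι → List V(G))
    (D : MetricGraph G G.unitLength →₀ ℤ)
    (h : ∀ i, (linearSystem (DivEquiv G G.unitLength)
      (D - listDivisor ((F i).map vertex))).Nonempty) :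
    ∃ n : ℕ, 1 ≤ n ∧ ∃ D' : V(G.subdivide fun _ => n) →₀ ℤ, D'.degree = D.degree ∧
      ∀ i, (linearSystem (G.subdivide fun _ => n).DivEquiv
        (D' - listDivisor ((F i).map (G.oldVertex _)))).Nonempty := by
  classical
  have := Fintype.ofFinite ι
  have hℓ : ∀ e, 0 < G.unitLength e := fun _ => one_pos
  choose E hE hDE using h
  simp only [divEquiv_iff G hℓ] at hDE
  choose f hf hfA using hDE
  choose S hS using fun i e =>
    ((isRational_iff hℓ).1 (hf i) e).exists_linearOffOn (zero_le_one (α := ℝ))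
  obtain ⟨P, hPdef⟩ : ∃ P : Finset ℝ, P = (insert 0 (insert 1
      (Finset.univ.biUnion fun i => Finset.univ.biUnion fun e => S i e))).filter
        (· ∈ Icc (0 : ℝ) 1) := ⟨_, rfl⟩
  have hP : ∀ t ∈ P, t ∈ Icc (0 : ℝ) 1 := fun t ht => by
    rw [hPdef] at ht
    exact (Finset.mem_filter.1 ht).2
  have h0 : 0 ∈ P := by simp [hPdef]
  have h1 : 1 ∈ P := by simp [hPdef]
  have hlin : ∀ i e, LinearOffOn (fun t => f i (edgePath e t)) P 0 1 := by
    intro i e a b ha hab hb hno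
    refine hS i e a b ha hab hb fun s hs hs' => hno s ?_ hs'
    rw [hPdef, Finset.mem_filter]
    refine ⟨Finset.mem_insert_of_mem (Finset.mem_insert_of_mem ?_),
      ha.trans hs'.1.le, hs'.2.le.trans hb⟩
    exact Finset.mem_biUnion.2 ⟨i, Finset.mem_univ i,
      Finset.mem_biUnion.2 ⟨e, Finset.mem_univ e, hs⟩⟩
  -- Integrality is needed for the positions and for the values of the functions there; the
  -- differences of positions are included to make `z` strictly increasing on `P`.
  obtain ⟨φ, z, hφ⟩ := exists_addMonoidHom_integral_pos
    (P ∪ (P ×ˢ P).image (fun q => q.2 - q.1) ∪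
      Finset.univ.biUnion fun i => Finset.univ.biUnion fun e =>
        P.image fun t => f i (edgePath e t))
  have hz : ∀ t ∈ P, φ t = z t := fun t ht =>
    (hφ t (Finset.mem_union_left _ (Finset.mem_union_left _ ht))).1
  have hmono : ∀ s ∈ P, ∀ t ∈ P, s < t → z s < z t := by
    intro s hs t ht hst
    obtain ⟨h2, h3⟩ := hφ (t - s) (Finset.mem_union_left _ (Finset.mem_union_right _
      (Finset.mem_image.2 ⟨(s, t), Finset.mem_product.2 ⟨hs, ht⟩, rfl⟩)))
    have h4 := h3 (sub_pos.2 hst)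
    rw [map_sub, hz s hs, hz t ht] at h2
    have h5 : z t - z s = z (t - s) := by exact_mod_cast h2
    omega
  have hfz : ∀ i e, ∀ t ∈ P, φ (f i (edgePath e t)) = z (f i (edgePath e t)) :=
    fun i e t ht => (hφ _ (Finset.mem_union_right _ (Finset.mem_biUnion.2 ⟨i, Finset.mem_univ i,
      Finset.mem_biUnion.2 ⟨e, Finset.mem_univ e, Finset.mem_image_of_mem _ ht⟩⟩))).1
  have hz1 : 0 < z 1 :=
    (hφ 1 (Finset.mem_union_left _ (Finset.mem_union_left _ h1))).2 one_pos
  obtain ⟨n, hn⟩ : ∃ n : ℕ, z 1 = n := ⟨(z 1).toNat, by omega⟩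
  have hn0 : 1 ≤ n := by omega
  refine ⟨n, hn0, Finsupp.mapDomain (toSubdivision G _ z) D, degree_mapDomain _ _, fun i => ?_⟩
  refine ⟨Finsupp.mapDomain (toSubdivision G _ z) (E i), mapDomain_nonneg _ (hE i), ?_⟩
  rw [subdivide_divEquiv_iff G hloop]
  have := mapDomain_toSubdivision_mem G hℓ hP h0 h1 hz hmono (hfz i) (hlin i) hn hn0
    (hfA i)
  rw [← Finsupp.mapDomain.addMonoidHom_apply, map_sub, map_sub] at this
  simp only [Finsupp.mapDomain.addMonoidHom_apply] at this
  rw [mapDomain_listDivisor, List.map_map] at this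
  exact this

end MetricGraph

/-! ### Existence of the minima and the two inequalities -/

section

open DivisorTheory

lemma Graph.isLeast_dgon_of_principal {α β : Type*} (G : Graph α β) [Finite V(G)]
    [Nonempty V(G)] {P : AddSubgroup (V(G) →₀ ℤ)} (hP : ∀ A ∈ P, A.degree = 0)
    (hR : ∀ D D', G.DivEquiv D D' ↔ D' - D ∈ P) (r : ℕ) :
    IsLeast (G.dgonDegrees r) (G.dgon r) ∧ 0 ≤ G.dgon r ∧
      ∀ D, RankGE G.DivEquiv r D → G.dgon r ≤ D.degree := by
  have := Fintype.ofFinite V(G)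
  have hdeg : ∀ A B, G.DivEquiv A B → 0 ≤ B → 0 ≤ A.degree := fun A B h hB => by
    have h1 := hP _ ((hR A B).1 h)
    rw [map_sub] at h1
    have := degree_nonneg hB
    omega
  have h := isLeast_rankDegrees hR hdeg (G.rankGE_smul_sum r)
  exact ⟨h.1, h.2.2, fun D hD => (isLeast_rankDegrees hR hdeg hD).2.1⟩

lemma Graph.isLeast_dgon {α β : Type*} (G : Graph α β) [Finite V(G)] [Fintype E(G)]
    [Nonempty V(G)] (hloop : G.Loopless) (r : ℕ) : IsLeast (G.dgonDegrees r) (G.dgon r) :=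
  (G.isLeast_dgon_of_principal (fun _ => degree_eq_zero_of_mem_principal)
    (G.divEquiv_iff hloop) r).1

lemma Graph.subdivide_dgon {α β : Type*} (G : Graph α β) [Finite V(G)] [Fintype E(G)]
    [Nonempty V(G)] (hloop : G.Loopless) (n : E(G) → ℕ) (r : ℕ) :
    0 ≤ (G.subdivide n).dgon r ∧
      ∀ D, RankGE (G.subdivide n).DivEquiv r D → (G.subdivide n).dgon r ≤ D.degree := by
  have : Nonempty V(G.subdivide n) := ‹Nonempty V(G)›.map (G.oldVertex n)
  exact ((G.subdivide n).isLeast_dgon_of_principal (P := G.subdivPrincipal n)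
    (fun _ => degree_eq_zero_of_mem_principal) (G.subdivide_divEquiv_iff hloop n) r).2

lemma Graph.isLeast_sdgon {α β : Type*} (G : Graph α β) [Finite V(G)] [Fintype E(G)]
    [Nonempty V(G)] (hloop : G.Loopless) (r : ℕ) : IsLeast (G.sdgonValues r) (G.sdgon r) := by
  have hbdd : BddBelow (G.sdgonValues r) :=
    ⟨0, by rintro _ ⟨n, -, rfl⟩; exact (G.subdivide_dgon hloop n r).1⟩
  exact ⟨Int.csInf_mem ⟨_, fun _ => 1, fun _ => le_rfl, rfl⟩ hbdd,
    fun d hd => csInf_le hbdd hd⟩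

namespace MetricGraph

/-- Transfer to a subdivision with an empty test preserves the degree of `D` and makes it equivalent
to an effective divisor there, where principal divisors have degree `0`. No separate computation of
degrees on the metric graph is needed. -/
lemma degree_nonneg_of_divEquiv {α β : Type*} (G : Graph α β) [Finite V(G)] [Fintype E(G)]
    (hloop : G.Loopless) (D D' : MetricGraph G G.unitLength →₀ ℤ)
    (h : DivEquiv G G.unitLength D D') (hD' : 0 ≤ D') : 0 ≤ D.degree := by
  obtain ⟨n, -, A, hA, hAl⟩ := exists_subdivision G hloop (fun _ : Unit => []) D
    (fun _ => ⟨D', hD', by simpa [listDivisor] using h⟩)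
  obtain ⟨B, hB, hAB⟩ := hAl ()
  rw [subdivide_divEquiv_iff G hloop] at hAB
  have h1 := degree_eq_zero_of_mem_principal hAB
  have h2 := degree_nonneg hB
  simp only [listDivisor, List.map_nil, List.sum_nil, sub_zero, map_sub] at h1
  omega

lemma isLeast_dgon {α β : Type*} (G : Graph α β) [Finite V(G)] [Fintype E(G)] [Nonempty V(G)]
    (hloop : G.Loopless) (r : ℕ) :
    IsLeast (dgonDegrees G G.unitLength r) (dgon G G.unitLength r) ∧
      ∀ D, RankGE (DivEquiv G G.unitLength) r D → dgon G G.unitLength r ≤ D.degree := by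
  have := Fintype.ofFinite V(G)
  have : Nonempty (MetricGraph G G.unitLength) := ‹Nonempty V(G)›.map vertex
  have hR := divEquiv_iff G (ℓ := G.unitLength) fun _ => one_pos
  have hdeg := degree_nonneg_of_divEquiv G hloop
  exact ⟨(isLeast_rankDegrees hR hdeg
      (rankGE_mapDomain_vertex G hloop (G.rankGE_smul_sum r))).1,
    fun D hD => (isLeast_rankDegrees hR hdeg hD).2.1⟩

lemma dgon_le_graph_dgon {α β : Type*} (G : Graph α β) [Finite V(G)] [Fintype E(G)]
    [Nonempty V(G)] (hloop : G.Loopless) (r : ℕ) : dgon G G.unitLength r ≤ G.dgon r := by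
  obtain ⟨D, hD, hDd⟩ := (G.isLeast_dgon hloop r).1
  have hrank : RankGE G.DivEquiv r D := ((rank_eq_iff (G.divEquiv_iff hloop)
    (fun A B h hB => by
      have h1 := degree_eq_zero_of_mem_principal ((G.divEquiv_iff hloop A B).1 h)
      rw [map_sub] at h1
      have := degree_nonneg hB
      omega)).1 hD).1
  rw [← hDd, ← degree_mapDomain vertex D]
  exact (isLeast_dgon G hloop r).2 _ (rankGE_mapDomain_vertex G hloop hrank)

lemma sdgon_le_dgon {α β : Type*} (G : Graph α β) [Finite V(G)] [Fintype E(G)]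
    [Nonempty V(G)] (hloop : G.Loopless) (r : ℕ) : G.sdgon r ≤ dgon G G.unitLength r := by
  obtain ⟨D, hD, hDd⟩ := (isLeast_dgon G hloop r).1.1
  have : Nonempty (MetricGraph G G.unitLength) := ‹Nonempty V(G)›.map vertex
  have hrank : RankGE (DivEquiv G G.unitLength) r D :=
    ((rank_eq_iff (divEquiv_iff G (ℓ := G.unitLength) fun _ => one_pos)
      (degree_nonneg_of_divEquiv G hloop)).1 hD).1
  -- The tests are indexed by vectors of `r` vertices, a finite type.
  obtain ⟨n, hn, D', hDD', hD'⟩ := exists_subdivision G hloop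
    (fun v : List.Vector V(G) r => v.toList) D
    (fun v => hrank _ (listDivisor_nonneg _) (by simp [degree_listDivisor]))
  have hrank' := subdivide_rankGE G hloop (fun _ => n) (fun _ => hn) (k := r) (D := D')
    fun l hl => hD' ⟨l, hl⟩
  rw [← hDd, ← hDD']
  exact ((G.isLeast_sdgon hloop r).2 ⟨_, fun _ => hn, rfl⟩).trans
    ((G.subdivide_dgon hloop _ r).2 D' hrank')

end MetricGraph

end

theorem mainTheorem10 {α β : Type*} (G : Graph α β) (hV : V(G).Finite) (hE : E(G).Finite)
    (hloop : G.Loopless) (hconn : G.IsConnected) (r : ℕ) (hr : 1 ≤ r) :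
    IsLeast (G.sdgonValues r) (G.sdgon r) ∧
    IsLeast (MetricGraph.dgonDegrees G G.unitLength r) (MetricGraph.dgon G G.unitLength r) ∧
    IsLeast (G.dgonDegrees r) (G.dgon r) ∧
    G.sdgon r ≤ MetricGraph.dgon G G.unitLength r ∧
    MetricGraph.dgon G G.unitLength r ≤ G.dgon r := by
  have : Finite V(G) := hV.to_subtype
  have := hE.fintype
  have : Nonempty V(G) := hconn.1.to_subtype
  exact ⟨G.isLeast_sdgon hloop r, (MetricGraph.isLeast_dgon G hloop r).1,
    G.isLeast_dgon hloop r, MetricGraph.sdgon_le_dgon G hloop r,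
    MetricGraph.dgon_le_graph_dgon G hloop r⟩
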